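/- **Theorem (1-to-2 cloning of Choi states of unitaries on $r$ qubits from the no-signalling principle).** Let $r\ge 0$ be an integer and $d=2^r$. For a unitary $U\in\mathcal U(d)$ let $|J_U\rangle=\frac1{\sqrt d}\sum_i U|i\rangle\otimes|i\rangle\in\mathbb C^d\otimes\mathbb C^d$ and let $\mathcal J=\{|J_U\rangle : U\in\mathcal U(d)\}$ be the set of Choi states of unitaries. Consider a probabilistic 1-to-2 cloning oracle for $\mathcal J$, not necessarily obeying quantum mechanics (it may be non-linear): on input $|\psi\rangle\langle\psi|$ with $\psi\in\mathcal J$ it outputs $$\mathcal C(|\psi\rangle\langle\psi|)=p\,\mathcal R(|\psi\rangle\langle\psi|)\otimes|0\rangle\langle0|+(1-p)\,\rho_\perp\otimes|1\rangle\langle1| ,\qquad 0<p\le1,$$ where $p$ is constant, the flag $|0\rangle$, $|1\rangle$ marks success or failure, $\rho_\perp$ is an arbitrary operator (it may depend on the input), and the successful output $\mathcal R(|\psi\rangle\langle\psi|)$ is the Choi state of a quantum channel on two copies of $\mathbb C^d$, i.e. a density operator $\omega$ on $(\mathbb C^d\otimes\mathbb C^d)^{\otimes2}$ with $\operatorname{Tr}_1\omega=d^{-2}\,\mathbb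 I$, where $\operatorname{Tr}_1$ is the partial trace over the first factor $\mathbb C^d$ of both pairs. Assume that $\mathcal C$ respects the no-signalling principle: if Alice and Bob share any bipartite state and Bob can choose between two measurements on his part, each of which leaves Alice, for every outcome, with a state $|\psi\rangle\langle\psi|$, $\psi\in\mathcal J$, to which she then applies $\mathcal C$, then Alice's output state averaged over Bob's outcomes does not depend on which measurement he chose. Then the worst case global cloning fidelity $F_{\rm wc}(\mathcal R)=\inf_{\psi\in\mathcal J}F\big(\mathcal R(|\psi\rangle\langle\psi|),|\psi\rangle\langle\psi|^{\otimes2}\big)$, where $F(\rho,\sigma)=(\operatorname{Tr}|\sqrt\rho\sqrt\sigma|)^2$ is the Uhlmann fidelity, satisfies $$F_{\rm wc}(\mathcal R)\le\frac{2^r+\sqrt{2^{2r}-1}}{2^{3r}} .$$ -/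

import Mathlib

open scoped ComplexOrder MatrixOrder Kronecker

namespace NoCloning

/-! ### Quantum states, tensor powers, fidelity -/

/-- The rank-one operator `|ψ⟩⟨ψ|`. -/
def proj {ι : Type*} (ψ : ι → ℂ) : Matrix ι ι ℂ := Matrix.vecMulVec ψ (star ψ)

/-- The tensor power `ρ^{⊗n}`, an operator on the space with basis `Fin n → ι`. -/
def tensorPower {ι : Type*} (n : ℕ) (ρ : Matrix ι ι ℂ) : Matrix (Fin n → ι) (Fin n → ι) ℂ :=
  Matrix.of fun f g => ∏ k, ρ (f k) (g k)

/-- Density operators, i.e. (possibly mixed) quantum states. -/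
def IsState {ι : Type*} [Fintype ι] (ρ : Matrix ι ι ℂ) : Prop :=
  ρ.PosSemidef ∧ ρ.trace = 1

/-- The Uhlmann fidelity `F(ρ, σ) = (Tr |√ρ √σ|)²`, where `|A| = √(A† A)`. -/
noncomputable def fidelity {ι : Type*} [Fintype ι] [DecidableEq ι] (ρ σ : Matrix ι ι ℂ) : ℝ :=
  (CFC.abs (CFC.sqrt ρ * CFC.sqrt σ)).trace.re ^ 2

/-- The partial trace over the second tensor factor. -/
def partialTraceRight {α β : Type*} [Fintype β] (M : Matrix (α × β) (α × β) ℂ) :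
    Matrix α α ℂ :=
  Matrix.of fun a a' => ∑ b, M (a, b) (a', b)

/-! ### Choi states -/

/-- The vector `|J_U⟩ = (1/√d) ∑ᵢ U|i⟩ ⊗ |i⟩`, whose coordinate at `(a, b)` is `U a b / √d`. -/
noncomputable def choiVector {d : ℕ} (U : Matrix (Fin d) (Fin d) ℂ) : Fin d × Fin d → ℂ :=
  fun x => U x.1 x.2 / (Real.sqrt d : ℂ)

/-- The set of Choi states of all unitaries on `ℂ^d`. -/
def choiStates (d : ℕ) : Set (Fin d × Fin d → ℂ) :=
  {ψ | ∃ U ∈ Matrix.unitaryGroup (Fin d) ℂ, ψ = choiVector U}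

/-- The partial trace of an operator on `(ℂ^d ⊗ ℂ^d)^{⊗m}` over the first factor `ℂ^d` of every
one of the `m` pairs. -/
def partialTraceFirst {d m : ℕ}
    (ω : Matrix (Fin m → Fin d × Fin d) (Fin m → Fin d × Fin d) ℂ) :
    Matrix (Fin m → Fin d) (Fin m → Fin d) ℂ :=
  Matrix.of fun g g' =>
    ∑ h : Fin m → Fin d, ω (fun k => (h k, g k)) (fun k => (h k, g' k))

/-- Choi states of quantum channels from `(ℂ^d)^{⊗m}` to `(ℂ^d)^{⊗m}`: the states on
`(ℂ^d ⊗ ℂ^d)^{⊗m}` (in each pair the first factor is the output and the second one the input of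
the channel) whose marginal on the input factors is maximally mixed. -/
def IsChoiState {d m : ℕ}
    (ω : Matrix (Fin m → Fin d × Fin d) (Fin m → Fin d × Fin d) ℂ) : Prop :=
  IsState ω ∧ partialTraceFirst ω = ((d : ℂ) ^ m)⁻¹ • 1

/-! ### Cloning oracles -/

/-- A probabilistic `n`-to-`m` cloning oracle for a set `S` of pure states. It succeeds with
probability `p > 0`; on success it turns `|ψ⟩⟨ψ|^{⊗n}`, `ψ ∈ S`, into the state
`clone (|ψ⟩⟨ψ|^{⊗n})`. Neither `clone` nor `fail` need be linear or positive; nothing is required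
of `clone` on other inputs, and nothing of `fail` on any input. -/
structure CloningOracle {ι : Type*} [Fintype ι] (S : Set (ι → ℂ)) (n m : ℕ) where
  p : ℝ
  p_pos : 0 < p
  p_le_one : p ≤ 1
  clone : Matrix (Fin n → ι) (Fin n → ι) ℂ → Matrix (Fin m → ι) (Fin m → ι) ℂ
  fail : Matrix (Fin n → ι) (Fin n → ι) ℂ → Matrix (Fin m → ι) (Fin m → ι) ℂ
  isState_clone : ∀ ψ ∈ S, IsState (clone (tensorPower n (proj ψ)))

variable {ι : Type*} [Fintype ι] {S : Set (ι → ℂ)} {n m : ℕ}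

/-- The full output of the oracle, with a flag that tells success (`0`) from failure (`1`):
`p • clone ρ ⊗ |0⟩⟨0| + (1 - p) • fail ρ ⊗ |1⟩⟨1|`. -/
noncomputable def CloningOracle.output (C : CloningOracle S n m)
    (ρ : Matrix (Fin n → ι) (Fin n → ι) ℂ) :
    Matrix ((Fin m → ι) × Fin 2) ((Fin m → ι) × Fin 2) ℂ :=
  C.p • (C.clone ρ ⊗ₖ Matrix.single (0 : Fin 2) (0 : Fin 2) (1 : ℂ)) +
    (1 - C.p) • (C.fail ρ ⊗ₖ Matrix.single (1 : Fin 2) (1 : Fin 2) (1 : ℂ))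

/-- The worst case global cloning fidelity of the oracle. -/
noncomputable def CloningOracle.worstCaseFidelity [DecidableEq ι] (C : CloningOracle S n m) :
    ℝ :=
  ⨅ ψ : S, fidelity (C.clone (tensorPower n (proj ψ.1))) (tensorPower m (proj ψ.1))

/-! ### The no-signalling principle -/

/-- Alice and Bob share the state `Ω` on `A ⊗ B`, and Bob's measurement with effects `M x` on `B`
prepares for Alice, with probability `w x`, the state `|ψ x⟩⟨ψ x|^{⊗n}` with `ψ x ∈ S`. -/
structure RemotelyPrepares [DecidableEq ι] (S : Set (ι → ℂ)) {n b k : ℕ}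
    (Ω : Matrix ((Fin n → ι) × Fin b) ((Fin n → ι) × Fin b) ℂ)
    (M : Fin k → Matrix (Fin b) (Fin b) ℂ) (w : Fin k → ℝ) (ψ : Fin k → ι → ℂ) : Prop where
  effect_posSemidef : ∀ x, (M x).PosSemidef
  sum_effect : ∑ x, M x = 1
  mem : ∀ x, ψ x ∈ S
  conditional_state : ∀ x,
    partialTraceRight (Ω * ((1 : Matrix (Fin n → ι) (Fin n → ι) ℂ) ⊗ₖ M x)) =
      w x • tensorPower n (proj (ψ x))

/-- The no-signalling principle for a (not necessarily quantum) operation `T` that accepts the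
inputs `|ψ⟩⟨ψ|^{⊗n}` with `ψ ∈ S`: whatever state Alice and Bob share, if Bob can choose between
two measurements each of which leaves Alice with inputs that `T` accepts, and Alice applies `T`,
then her average output state does not depend on Bob's choice. -/
def NoSignalling [DecidableEq ι] {κ : Type*} (S : Set (ι → ℂ)) (n : ℕ)
    (T : Matrix (Fin n → ι) (Fin n → ι) ℂ → Matrix κ κ ℂ) : Prop :=
  ∀ (b : ℕ) (Ω : Matrix ((Fin n → ι) × Fin b) ((Fin n → ι) × Fin b) ℂ), IsState Ω →
    ∀ (k : ℕ) (M : Fin k → Matrix (Fin b) (Fin b) ℂ) (w : Fin k → ℝ) (ψ : Fin k → ι → ℂ),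
      RemotelyPrepares S Ω M w ψ →
    ∀ (k' : ℕ) (M' : Fin k' → Matrix (Fin b) (Fin b) ℂ) (w' : Fin k' → ℝ)
      (ψ' : Fin k' → ι → ℂ), RemotelyPrepares S Ω M' w' ψ' →
    ∑ x, w x • T (tensorPower n (proj (ψ x))) = ∑ y, w' y • T (tensorPower n (proj (ψ' y)))

end NoCloning

open scoped Matrix
open MeasureTheory

namespace NoCloning

/-! ### Orthogonal bases of Hermitian unitary matrices -/

/-! No-signalling forces linearity. Each Choi state lies in an orthonormal basis of Choi states, the
translates `σ k * U` of a Pauli basis. A linear relation among projectors can therefore be turned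
into two decompositions of the identity with nonnegative weights. Bob can steer Alice to either one,
and comparing her outputs transfers the relation to the clones (`CloningOracle.exists_linearMap`).
So the clone of `|J_U⟩` is `ρ_U = L(|J_U⟩⟨J_U|)` with `L` real-linear.

With two copies regrouped into inputs and outputs, `|J_U⟩^{⊗2}` is `d⁻¹` times the vectorised
operator `U ⊗ U`, which splits into its restrictions `symOp s U` to the symmetric (`s = 1`) and
antisymmetric (`s = -1`) subspaces, with projections `Π_s`. Let `Q_s` be the Haar average of `⟨symOp
s U| ρ_U |symOp s U⟩` and `T_s` that of `Tr(ρ_U (Π_sᵀ ⊗ Π_s))`. The marginal condition gives `T_s ≤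
d⁻² · d(d + s)/2`. The core is `Q_s ≤ T_s` (`integral_quad_symOp_le`); Cauchy-Schwarz alone would
lose the factor `dim Π_s = d(d + s)/2`.

To gain that factor, apply Bessel's inequality to the tangent vectors `gen (σ k) * symOp s U`, which
are orthogonal (`sum_quad_gen_le`). The averaged quadratic forms of these vectors are computable.
Haar invariance moves the rotations `(1 ± iσ_k)/√2` from the test vector to the input state. There,
linearity and a four-term relation between Choi states apply (`integral_quad_gen`). Summing over `k`
leaves only `Q_s` and the average of `L 1`, which Schur's lemma evaluates as a multiple of `T_s`
(`trace_symProj_mul_twirl`). Bessel's inequality becomes a multiple of `Q_s - T_s ≤ 0`, the multiple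
being positive when `d + 3s > 0`. For `d = 2`, `s = -1` the subspace is a line and Cauchy-Schwarz is
enough.

Finally, `(1 + η) Q₁ + (1 + η⁻¹) Q₋₁` bounds `d²` times the worst-case fidelity, and the optimal `η`
gives the result. -/

/-- A family of Hermitian unitary matrices that is an orthogonal basis of the space of all
matrices (for the Hilbert-Schmidt inner product) and contains the identity. -/
structure IsHermitianUnitaryBasis {n K : Type*} [Fintype n] [DecidableEq n] [Fintype K]
    [DecidableEq K] (σ : K → Matrix n n ℂ) (k₀ : K) : Prop where
  isHermitian : ∀ k, (σ k)ᴴ = σ k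
  mul_self : ∀ k, σ k * σ k = 1
  eq_one : σ k₀ = 1
  trace_mul : ∀ k l, (σ k * σ l).trace = if k = l then (Fintype.card n : ℂ) else 0
  sum_mul : ∀ a b c e, ∑ k, σ k a b * σ k c e =
    if a = e ∧ b = c then (Fintype.card n : ℂ) else 0

theorem IsHermitianUnitaryBasis.kronecker {n m K L : Type*} [Fintype n] [DecidableEq n]
    [Fintype m] [DecidableEq m] [Fintype K] [DecidableEq K] [Fintype L] [DecidableEq L]
    {σ : K → Matrix n n ℂ} {k₀ : K} {τ : L → Matrix m m ℂ} {l₀ : L}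
    (hσ : IsHermitianUnitaryBasis σ k₀) (hτ : IsHermitianUnitaryBasis τ l₀) :
    IsHermitianUnitaryBasis (fun x : K × L => σ x.1 ⊗ₖ τ x.2) (k₀, l₀) where
  isHermitian x := by
    rw [Matrix.conjTranspose_kronecker, hσ.isHermitian, hτ.isHermitian]
  mul_self x := by
    rw [← Matrix.mul_kronecker_mul, hσ.mul_self, hτ.mul_self, Matrix.one_kronecker_one]
  eq_one := by simp [hσ.eq_one, hτ.eq_one]
  trace_mul x y := by
    rw [← Matrix.mul_kronecker_mul, Matrix.trace_kronecker, hσ.trace_mul, hτ.trace_mul]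
    by_cases h1 : x.1 = y.1 <;> by_cases h2 : x.2 = y.2 <;> simp [Prod.ext_iff, h1, h2]
  sum_mul a b c e := by
    have h : ∑ x : K × L, (σ x.1 ⊗ₖ τ x.2) a b * (σ x.1 ⊗ₖ τ x.2) c e =
        (∑ k, σ k a.1 b.1 * σ k c.1 e.1) * ∑ l, τ l a.2 b.2 * τ l c.2 e.2 := by
      rw [Finset.sum_mul_sum, Fintype.sum_prod_type]
      refine Finset.sum_congr rfl fun _ _ => Finset.sum_congr rfl fun _ _ => ?_
      simp only [Matrix.kroneckerMap_apply]
      ring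
    rw [h, hσ.sum_mul, hτ.sum_mul]
    by_cases h1 : a.1 = e.1 <;> by_cases h2 : a.2 = e.2 <;> by_cases h3 : b.1 = c.1 <;>
      by_cases h4 : b.2 = c.2 <;> simp [Prod.ext_iff, h1, h2, h3, h4]

theorem IsHermitianUnitaryBasis.reindex {n m K : Type*} [Fintype n] [DecidableEq n]
    [Fintype m] [DecidableEq m] [Fintype K] [DecidableEq K]
    {σ : K → Matrix n n ℂ} {k₀ : K} (hσ : IsHermitianUnitaryBasis σ k₀) (e : m ≃ n) :
    IsHermitianUnitaryBasis (fun k => (σ k).submatrix e e) k₀ where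
  isHermitian k := by rw [Matrix.conjTranspose_submatrix, hσ.isHermitian]
  mul_self k := by rw [Matrix.submatrix_mul_equiv, hσ.mul_self, Matrix.submatrix_one_equiv]
  eq_one := by rw [hσ.eq_one, Matrix.submatrix_one_equiv]
  trace_mul k l := by
    rw [Matrix.submatrix_mul_equiv, ← Fintype.card_congr e.symm, ← hσ.trace_mul k l]
    exact e.sum_comp fun i => (σ k * σ l) i i
  sum_mul a b c f := by
    simp [Matrix.submatrix_apply, hσ.sum_mul, Fintype.card_congr e]

/-- The Pauli matrices, together with the identity. -/
noncomputable def pauli : Fin 4 → Matrix (Fin 2) (Fin 2) ℂ :=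
  ![1, !![0, 1; 1, 0], !![0, -Complex.I; Complex.I, 0], !![1, 0; 0, -1]]

theorem isHermitianUnitaryBasis_pauli : IsHermitianUnitaryBasis pauli 0 where
  isHermitian k := by
    fin_cases k <;> ext i j <;> fin_cases i <;> fin_cases j <;> simp [pauli]
  mul_self k := by
    fin_cases k <;> ext i j <;> fin_cases i <;> fin_cases j <;> simp [pauli, Matrix.mul_apply]
  eq_one := rfl
  trace_mul k l := by
    fin_cases k <;> fin_cases l <;>
      simp [pauli, Matrix.trace] <;> norm_num
  sum_mul a b c e := by
    fin_cases a <;> fin_cases b <;> fin_cases c <;> fin_cases e <;>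
      simp [pauli, Fin.sum_univ_four] <;> norm_num

/-- Tensor products of Pauli matrices. Unitarity keeps `σ k * U` a unitary; hermiticity makes `(1 ±
iσ_k)/√2` unitary as well. -/
theorem exists_isHermitianUnitaryBasis (r : ℕ) :
    ∃ (k : ℕ) (σ : Fin k → Matrix (Fin (2 ^ r)) (Fin (2 ^ r)) ℂ) (k₀ : Fin k),
      IsHermitianUnitaryBasis σ k₀ := by
  induction r with
  | zero =>
    refine ⟨1, fun _ => 1, 0, by simp, by simp, rfl, fun k l => ?_, fun a b c e => ?_⟩
    · simp [Subsingleton.elim k l]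
    · have h (x y : Fin (2 ^ 0)) : x = y := Subsingleton.elim (α := Fin 1) x y
      rw [h b a, h c a, h e a]
      simp
  | succ r ih =>
    obtain ⟨k, σ, k₀, hσ⟩ := ih
    have h := (hσ.kronecker isHermitianUnitaryBasis_pauli).reindex
      ((finCongr (pow_succ 2 r)).trans finProdFinEquiv.symm)
    let f : Fin (k * 4) ≃ Fin k × Fin 4 := finProdFinEquiv.symm
    refine ⟨k * 4, _, f.symm (k₀, 0), fun x => h.isHermitian (f x), fun x => h.mul_self (f x),
      ?_, fun x y => ?_, fun a b c e => ?_⟩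
    · simpa using h.eq_one
    · simpa using h.trace_mul (f x) (f y)
    · rw [← h.sum_mul a b c e]
      exact f.sum_comp fun x => ((σ x.1 ⊗ₖ pauli x.2).submatrix _ _) a b *
        ((σ x.1 ⊗ₖ pauli x.2).submatrix _ _) c e

/-! ### Fidelity with a pure state -/

theorem posSemidef_proj {ι : Type*} [Finite ι] (φ : ι → ℂ) : (proj φ).PosSemidef :=
  Matrix.posSemidef_vecMulVec_self_star φ

/-- A rank-one projection is its own square root, and compressing `ρ` by it gives `c • proj φ` with
`c = ⟨φ|ρ|φ⟩`; hence the absolute value is `√c • proj φ`. -/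
theorem fidelity_proj {ι : Type*} [Fintype ι] [DecidableEq ι] {ρ : Matrix ι ι ℂ}
    (hρ : ρ.PosSemidef) {φ : ι → ℂ} (hφ : star φ ⬝ᵥ φ = 1) :
    fidelity ρ (proj φ) = (star φ ⬝ᵥ ρ.mulVec φ).re := by
  have hmul : proj φ * proj φ = proj φ := by
    simp [proj, Matrix.vecMulVec_mul_vecMulVec, hφ]
  have hproj : (0 : Matrix ι ι ℂ) ≤ proj φ := (posSemidef_proj φ).nonneg
  have hsqrt : CFC.sqrt (proj φ) = proj φ := CFC.sqrt_unique hmul hproj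
  obtain ⟨c, hc, hc'⟩ : ∃ c : ℝ, 0 ≤ c ∧ star φ ⬝ᵥ ρ.mulVec φ = c := by
    have h := hρ.dotProduct_mulVec_nonneg φ
    refine ⟨(star φ ⬝ᵥ ρ.mulVec φ).re, (Complex.le_def.1 h).1, ?_⟩
    exact Complex.ext rfl (Complex.le_def.1 h).2.symm
  have hsand : proj φ * ρ * proj φ = c • proj φ := by
    rw [proj, Matrix.vecMulVec_mul, Matrix.vecMulVec_mul_vecMulVec, ← Matrix.dotProduct_mulVec,
      hc']
    ext; simp [Matrix.vecMulVec_apply, mul_left_comm]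
  have habs : CFC.abs (CFC.sqrt ρ * CFC.sqrt (proj φ)) = Real.sqrt c • proj φ := by
    refine CFC.sqrt_unique ?_ (smul_nonneg (Real.sqrt_nonneg c) hproj)
    have h1 : star (CFC.sqrt ρ) = CFC.sqrt ρ := (CFC.sqrt_nonneg ρ).isSelfAdjoint
    have h2 : star (proj φ) = proj φ := hproj.isSelfAdjoint
    rw [hsqrt, star_mul, h1, h2, mul_assoc, ← mul_assoc (CFC.sqrt ρ),
      CFC.sqrt_mul_sqrt_self ρ hρ.nonneg, ← mul_assoc, hsand, smul_mul_smul_comm, hmul,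
      Real.mul_self_sqrt hc]
  have htr : (proj φ).trace = 1 := by
    rw [proj, Matrix.trace_vecMulVec, dotProduct_comm, hφ]
  rw [fidelity, habs, hc', Matrix.trace_smul, htr]
  simp [Real.sq_sqrt hc]

theorem fidelity_nonneg {ι : Type*} [Fintype ι] [DecidableEq ι] (ρ σ : Matrix ι ι ℂ) :
    0 ≤ fidelity ρ σ := sq_nonneg _

theorem CloningOracle.worstCaseFidelity_le {ι : Type*} [Fintype ι] [DecidableEq ι]
    {S : Set (ι → ℂ)} {n m : ℕ} (C : CloningOracle S n m) {ψ : ι → ℂ} (hψ : ψ ∈ S) :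
    C.worstCaseFidelity ≤
      fidelity (C.clone (tensorPower n (proj ψ))) (tensorPower m (proj ψ)) :=
  ciInf_le (f := fun ψ : S => fidelity (C.clone (tensorPower n (proj ψ.1)))
    (tensorPower m (proj ψ.1))) ⟨0, by rintro _ ⟨x, rfl⟩; exact fidelity_nonneg _ _⟩ ⟨ψ, hψ⟩

/-! ### Consequences of the no-signalling principle -/

theorem tensorPower_one_apply {ι : Type*} (ρ : Matrix ι ι ℂ) (f g : Fin 1 → ι) :
    tensorPower 1 ρ f g = ρ (f 0) (g 0) := by
  simp [tensorPower]

/-- The success flag isolates the block `p • clone`, and `p > 0` cancels; the failure branch never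
matters. -/
theorem CloningOracle.sum_smul_clone {ι : Type*} [Fintype ι] {S : Set (ι → ℂ)} {m : ℕ} (C : CloningOracle S 1 m)
    {K : Type*} [Fintype K] {c c' : K → ℝ} {ρ : K → Matrix (Fin 1 → ι) (Fin 1 → ι) ℂ}
    (h : ∑ x, c x • C.output (ρ x) = ∑ x, c' x • C.output (ρ x)) :
    ∑ x, c x • C.clone (ρ x) = ∑ x, c' x • C.clone (ρ x) := by
  have hp := C.p_pos.ne'
  refine smul_right_injective _ hp ?_
  ext i j
  have h' := congrFun (congrFun h (i, 0)) (j, 0)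
  simp only [CloningOracle.output, Matrix.sum_apply, Matrix.smul_apply, Matrix.add_apply,
    Matrix.kroneckerMap_apply, Matrix.single_apply, Finset.smul_sum] at h' ⊢
  simpa [mul_left_comm] using h'

theorem _root_.LinearMap.exists_comp_eq_of_ker_le {V W Z : Type*} [AddCommGroup V] [Module ℝ V]
    [AddCommGroup W] [Module ℝ W] [AddCommGroup Z] [Module ℝ Z] (f : V →ₗ[ℝ] W)
    (g : V →ₗ[ℝ] Z) (h : f.ker ≤ g.ker) : ∃ l : W →ₗ[ℝ] Z, ∀ v, l (f v) = g v := by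
  obtain ⟨l, hl⟩ := LinearMap.exists_extend
    ((f.ker.liftQ g h) ∘ₗ f.quotKerEquivRange.symm.toLinearMap)
  refine ⟨l, fun v => ?_⟩
  have := LinearMap.congr_fun hl ⟨f v, LinearMap.mem_range_self f v⟩
  simp only [LinearMap.comp_apply, Submodule.subtype_apply] at this
  rw [this]
  have h2 : f.quotKerEquivRange.symm ⟨f v, LinearMap.mem_range_self f v⟩ = f.ker.mkQ v := by
    rw [LinearEquiv.symm_apply_eq]; rfl
  simp [h2]

section NoSignalling

variable {ι : Type*} [Fintype ι] [DecidableEq ι]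

/-- Bob steers any decomposition of the identity by measuring half of a maximally entangled
state. -/
theorem exists_remotelyPrepares {S : Set (ι → ℂ)} [Nonempty ι] :
    ∃ (b : ℕ) (Ω : Matrix ((Fin 1 → ι) × Fin b) ((Fin 1 → ι) × Fin b) ℂ), IsState Ω ∧
      ∀ (k : ℕ) (c : Fin k → ℝ) (ψ : Fin k → ι → ℂ), (∀ x, 0 ≤ c x) → (∀ x, ψ x ∈ S) →
        ∑ x, c x • proj (ψ x) = 1 →
        ∃ M, RemotelyPrepares S Ω M (fun x => (Fintype.card ι : ℝ)⁻¹ * c x) ψ := by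
  let e : ι ≃ Fin (Fintype.card ι) := Fintype.equivFin ι
  let φ : (Fin 1 → ι) × Fin (Fintype.card ι) → ℂ := fun x => if e (x.1 0) = x.2 then 1 else 0
  have hφ : star φ ⬝ᵥ φ = Fintype.card ι := by
    have h (x) : star (φ x) * φ x = if e (x.1 0) = x.2 then 1 else 0 := by
      simp only [φ]
      split_ifs <;> simp
    simp only [dotProduct, Pi.star_apply, h, Fintype.sum_prod_type, Finset.sum_ite_eq,
      Finset.mem_univ, if_true]
    simp
  have hcard : (Fintype.card ι : ℂ) ≠ 0 := by simp
  refine ⟨Fintype.card ι, (Fintype.card ι : ℝ)⁻¹ • proj φ,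
    ⟨(posSemidef_proj φ).smul (by positivity), ?_⟩, ?_⟩
  · rw [Matrix.trace_smul, proj, Matrix.trace_vecMulVec, dotProduct_comm, hφ]
    simp
  intro k c ψ hc hψ hsum
  -- An effect on one half of a maximally entangled state appears transposed on the other half,
  -- hence the conjugated vectors.
  refine ⟨fun x => c x • (proj (star (ψ x))).submatrix e.symm e.symm,
    fun x => ((posSemidef_proj _).submatrix _).smul (hc x), ?_, hψ, fun x => ?_⟩
  · ext i j
    have h := congrFun (congrFun hsum (e.symm j)) (e.symm i)
    simp only [Matrix.sum_apply, Matrix.smul_apply, Matrix.one_apply, EmbeddingLike.apply_eq_iff_eq,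
      proj, Matrix.vecMulVec_apply, Matrix.submatrix_apply] at h ⊢
    simp only [eq_comm (a := i), ← h]
    refine Finset.sum_congr rfl fun x _ => ?_
    simp [mul_comm]
  · ext f g
    simp only [partialTraceRight, Matrix.of_apply, Matrix.mul_apply, Fintype.sum_prod_type,
      Matrix.kroneckerMap_apply, Matrix.smul_apply, tensorPower_one_apply, proj,
      Matrix.vecMulVec_apply, Matrix.one_apply, Matrix.submatrix_apply, φ, Pi.star_apply]
    simp only [ite_mul, mul_ite, zero_mul, mul_zero, one_mul, star_one, star_zero, mul_one,
      apply_ite star, smul_zero, smul_ite]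
    rw [Finset.sum_eq_single (e (f 0))]
    · rw [Finset.sum_eq_single g]
      · rw [Finset.sum_eq_single (e (g 0))]
        · simp
          ring
        · intro b _ hb; simp [hb.symm]
        · simp
      · intro b _ hb; simp [hb]
      · simp
    · intro b _ hb; simp [hb.symm]
    · simp

theorem NoSignalling.sum_smul_eq {κ : Type*} {S : Set (ι → ℂ)} [Nonempty ι]
    {T : Matrix (Fin 1 → ι) (Fin 1 → ι) ℂ → Matrix κ κ ℂ} (hT : NoSignalling S 1 T)
    {K : Type*} [Fintype K] {c c' : K → ℝ} {ψ : K → ι → ℂ} (hc : ∀ x, 0 ≤ c x)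
    (hc' : ∀ x, 0 ≤ c' x) (hψ : ∀ x, ψ x ∈ S) (hsum : ∑ x, c x • proj (ψ x) = 1)
    (hsum' : ∑ x, c' x • proj (ψ x) = 1) :
    ∑ x, c x • T (tensorPower 1 (proj (ψ x))) = ∑ x, c' x • T (tensorPower 1 (proj (ψ x))) := by
  obtain ⟨b, Ω, hΩ, h⟩ := exists_remotelyPrepares (ι := ι) (S := S)
  let e := (Fintype.equivFin K).symm
  obtain ⟨M, hM⟩ := h _ (c ∘ e) (ψ ∘ e) (fun _ => hc _) (fun _ => hψ _)
    (by rw [← hsum]; exact e.sum_comp fun x => c x • proj (ψ x))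
  obtain ⟨M', hM'⟩ := h _ (c' ∘ e) (ψ ∘ e) (fun _ => hc' _) (fun _ => hψ _)
    (by rw [← hsum']; exact e.sum_comp fun x => c' x • proj (ψ x))
  have key := hT b Ω hΩ _ M _ _ hM _ M' _ _ hM'
  simp only [mul_smul, ← Finset.smul_sum, Function.comp_apply] at key
  have hinj := smul_right_injective (Matrix κ κ ℂ)
    (r := (Fintype.card ι : ℝ)⁻¹) (by positivity) key
  rwa [e.sum_comp fun x => c x • T (tensorPower 1 (proj (ψ x))),
    e.sum_comp fun x => c' x • T (tensorPower 1 (proj (ψ x)))] at hinj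

/-- If every state of `S` belongs to an orthonormal basis of states of `S`, then a cloner that
respects the no-signalling principle acts linearly on `S`. -/
theorem CloningOracle.exists_linearMap {S : Set (ι → ℂ)} [Nonempty ι] {m : ℕ}
    (C : CloningOracle S 1 m) (hC : NoSignalling S 1 C.output) {K : Type*} [Fintype K]
    [DecidableEq K] (k₀ : K) (B : S → K → S) (hB₀ : ∀ ψ, B ψ k₀ = ψ)
    (hB : ∀ ψ, ∑ k, proj (B ψ k).1 = 1) :
    ∃ L : Matrix ι ι ℂ →ₗ[ℝ] Matrix (Fin m → ι) (Fin m → ι) ℂ,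
      ∀ ψ ∈ S, L (proj ψ) = C.clone (tensorPower 1 (proj ψ)) := by
  suffices h : (Finsupp.linearCombination ℝ fun ψ : S => proj ψ.1).ker ≤
      (Finsupp.linearCombination ℝ fun ψ : S => C.clone (tensorPower 1 (proj ψ.1))).ker by
    obtain ⟨L, hL⟩ := LinearMap.exists_comp_eq_of_ker_le _ _ h
    refine ⟨L, fun ψ hψ => ?_⟩
    simpa using hL (Finsupp.single ⟨ψ, hψ⟩ 1)
  intro c hc
  rw [LinearMap.mem_ker, Finsupp.linearCombination_apply, Finsupp.sum,
    ← Finset.sum_coe_sort] at hc ⊢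
  by_cases h0 : c = 0
  · subst h0; simp
  let N : ℝ := ∑ x : c.support, |c x|
  have hN : 0 < N := by
    obtain ⟨x, hx⟩ := Finsupp.support_nonempty_iff.2 h0
    refine Finset.sum_pos' (fun _ _ => abs_nonneg _) ⟨⟨x, hx⟩, Finset.mem_univ _, ?_⟩
    exact abs_pos.2 (Finsupp.mem_support_iff.1 hx)
  -- Mix the bases through the states of the support with weights `|c| / N`. Shifting the weight of
  -- the `k₀` member by `c / N` keeps it nonnegative, and does not change the sum of projectors
  -- because `c` is a relation.
  let a : c.support × K → ℝ := fun x => N⁻¹ * |c x.1|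
  let a' : c.support × K → ℝ := fun x => a x + if x.2 = k₀ then N⁻¹ * c x.1 else 0
  have ha : ∀ x, 0 ≤ a x := fun x => by positivity
  have ha' : ∀ x, 0 ≤ a' x := fun x => by
    by_cases h : x.2 = k₀
    · simp only [a', a, h, if_true, ← mul_add]
      have := neg_abs_le (c x.1)
      exact mul_nonneg (by positivity) (by linarith)
    · simpa [a', h] using ha x
  have hdiff {E : Type _} [AddCommGroup E] [Module ℝ E] (v : S → E) :
      ∑ x, a' x • v (B x.1 x.2) = ∑ x, a x • v (B x.1 x.2) +
        N⁻¹ • ∑ x : c.support, c x • v x := by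
    simp only [a', add_smul, Finset.sum_add_distrib, add_right_inj]
    rw [Fintype.sum_prod_type, Finset.smul_sum]
    simp [ite_smul, hB₀, mul_smul]
  have h1 : ∑ x, a x • proj (B x.1 x.2).1 = 1 := by
    rw [Fintype.sum_prod_type]
    simp only [a, ← Finset.smul_sum, hB, ← Finset.sum_smul, ← Finset.mul_sum]
    change (N⁻¹ * N) • _ = _
    rw [inv_mul_cancel₀ hN.ne', one_smul]
  have h2 : ∑ x, a' x • proj (B x.1 x.2).1 = 1 := by
    rw [hdiff fun ψ => proj ψ.1, h1, hc, smul_zero, add_zero]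
  have h3 := C.sum_smul_clone (hC.sum_smul_eq (ψ := fun x : c.support × K => (B x.1 x.2).1)
    ha ha' (fun _ => Subtype.property _) h1 h2)
  rw [hdiff fun ψ => C.clone (tensorPower 1 (proj ψ.1))] at h3
  exact (smul_eq_zero.1 (left_eq_add.1 h3)).resolve_left (inv_pos.2 hN).ne'

end NoSignalling

/-! ### The swap operator and the projections onto its eigenspaces -/

section Swap

variable {n : Type*} [DecidableEq n]

/-- The operator that swaps two tensor factors. -/
def swapMatrix (n : Type*) [DecidableEq n] : Matrix (n × n) (n × n) ℂ :=
  Matrix.of fun i j => if i.1 = j.2 ∧ i.2 = j.1 then 1 else 0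

theorem swapMatrix_mul_apply [Fintype n] (M : Matrix (n × n) (n × n) ℂ) (i j : n × n) :
    (swapMatrix n * M) i j = M i.swap j := by
  rw [Matrix.mul_apply, Finset.sum_eq_single i.swap]
  · simp [swapMatrix]
  · intro b _ hb
    have : ¬ (i.1 = b.2 ∧ i.2 = b.1) := fun h => hb (Prod.ext h.2.symm h.1.symm)
    simp [swapMatrix, this]
  · simp

theorem mul_swapMatrix_apply [Fintype n] (M : Matrix (n × n) (n × n) ℂ) (i j : n × n) :
    (M * swapMatrix n) i j = M i j.swap := by
  rw [Matrix.mul_apply, Finset.sum_eq_single j.swap]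
  · simp [swapMatrix]
  · intro b _ hb
    have : ¬ (b.1 = j.2 ∧ b.2 = j.1) := fun h => hb (Prod.ext h.1 h.2)
    simp [swapMatrix, this]
  · simp

theorem swapMatrix_mul_self [Fintype n] : swapMatrix n * swapMatrix n = 1 := by
  ext i j
  rw [swapMatrix_mul_apply]
  by_cases h : i = j
  · subst h
    simp [swapMatrix]
  · have : ¬ (i.2 = j.2 ∧ i.1 = j.1) := fun h' => h (Prod.ext h'.2 h'.1)
    simp [swapMatrix, h, this]

theorem conjTranspose_swapMatrix : (swapMatrix n)ᴴ = swapMatrix n := by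
  ext i j
  simp [swapMatrix, apply_ite (starRingEnd ℂ), and_comm, eq_comm]

theorem swapMatrix_mul_kronecker [Fintype n] (A B : Matrix n n ℂ) :
    swapMatrix n * (A ⊗ₖ B) = (B ⊗ₖ A) * swapMatrix n := by
  ext i j
  simp [swapMatrix_mul_apply, mul_swapMatrix_apply, mul_comm]

theorem trace_kronecker_mul_swapMatrix [Fintype n] (A B : Matrix n n ℂ) :
    ((A ⊗ₖ B) * swapMatrix n).trace = (A * B).trace := by
  simp only [Matrix.trace, Matrix.diag, mul_swapMatrix_apply]
  simp [Matrix.mul_apply, Fintype.sum_prod_type]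

/-- The projection onto the symmetric (`s = 1`) or antisymmetric (`s = -1`) subspace. -/
noncomputable def symProj (n : Type*) [DecidableEq n] (s : ℝ) :
    Matrix (n × n) (n × n) ℂ :=
  (2 : ℂ)⁻¹ • (1 + (s : ℂ) • swapMatrix n)

theorem trace_kronecker_mul_symProj [Fintype n] (s : ℝ) (A B : Matrix n n ℂ) :
    ((A ⊗ₖ B) * symProj n s).trace = 2⁻¹ * (A.trace * B.trace + s * (A * B).trace) := by
  rw [symProj, mul_smul_comm, mul_add, mul_smul_comm, mul_one, Matrix.trace_smul,
    Matrix.trace_add, Matrix.trace_smul, trace_kronecker_mul_swapMatrix, Matrix.trace_kronecker]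
  simp

theorem trace_symProj [Fintype n] (s : ℝ) : (symProj n s).trace =
    2⁻¹ * (Fintype.card n * (Fintype.card n + s)) := by
  have h := trace_kronecker_mul_symProj (n := n) s 1 1
  rw [Matrix.one_kronecker_one, one_mul] at h
  rw [h]
  simp
  ring

theorem conjTranspose_symProj (s : ℝ) : (symProj n s)ᴴ = symProj n s := by
  simp [symProj, Matrix.conjTranspose_smul, conjTranspose_swapMatrix]

theorem swapMatrix_mul_symProj [Fintype n] {s : ℝ} (hs : s ^ 2 = 1) :
    swapMatrix n * symProj n s = (s : ℂ) • symProj n s := by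
  have hs' : (s : ℂ) * s = 1 := by exact_mod_cast (sq s).symm.trans hs
  rw [symProj, mul_smul_comm, mul_add, mul_smul_comm, swapMatrix_mul_self, smul_comm (s : ℂ),
    smul_add (s : ℂ), smul_smul (s : ℂ), hs', mul_one, one_smul, add_comm]

theorem symProj_mul_swapMatrix [Fintype n] {s : ℝ} (hs : s ^ 2 = 1) :
    symProj n s * swapMatrix n = (s : ℂ) • symProj n s := by
  have h := congrArg Matrix.conjTranspose (swapMatrix_mul_symProj (n := n) hs)
  simpa [Matrix.conjTranspose_smul, conjTranspose_symProj, conjTranspose_swapMatrix] using h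

theorem symProj_mul_self [Fintype n] {s : ℝ} (hs : s ^ 2 = 1) : symProj n s * symProj n s = symProj n s := by
  have hs' : (s : ℂ) * s = 1 := by exact_mod_cast (sq s).symm.trans hs
  nth_rewrite 1 [symProj]
  rw [smul_mul_assoc, add_mul, one_mul, smul_mul_assoc, swapMatrix_mul_symProj hs, smul_smul, hs',
    one_smul, ← two_smul ℂ, smul_smul]
  simp

theorem symProj_mul_kronecker_self [Fintype n] (s : ℝ) (A : Matrix n n ℂ) :
    symProj n s * (A ⊗ₖ A) = (A ⊗ₖ A) * symProj n s := by
  simp only [symProj, smul_mul_assoc, mul_smul_comm, add_mul, mul_add, one_mul, mul_one,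
    swapMatrix_mul_kronecker]

theorem symProj_one_add_symProj_neg_one : symProj n 1 + symProj n (-1) = 1 := by
  rw [symProj, symProj, ← smul_add]
  have : (1 + ((1 : ℝ) : ℂ) • swapMatrix n + (1 + ((-1 : ℝ) : ℂ) • swapMatrix n)) =
      (2 : ℂ) • 1 := by
    rw [two_smul]; simp; abel
  rw [this, smul_smul]
  simp

theorem symProj_mul_kronecker_mul_symProj [Fintype n] {s : ℝ} (hs : s ^ 2 = 1) (A B : Matrix n n ℂ) :
    symProj n s * (A ⊗ₖ B) * symProj n s =
      (2 : ℂ)⁻¹ • (symProj n s * (A ⊗ₖ B + B ⊗ₖ A)) := by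
  have hs' : (s : ℂ) * s = 1 := by exact_mod_cast (sq s).symm.trans hs
  nth_rewrite 2 [symProj]
  rw [mul_smul_comm, mul_add, mul_one, mul_smul_comm, mul_assoc, ← swapMatrix_mul_kronecker,
    ← mul_assoc, symProj_mul_swapMatrix hs, smul_mul_assoc, smul_smul, hs', one_smul, mul_add]

end Swap

/-! ### Completeness relations of a Hermitian unitary basis -/

namespace IsHermitianUnitaryBasis

variable {n K : Type*} [Fintype n] [DecidableEq n] [Fintype K] [DecidableEq K]
  {σ : K → Matrix n n ℂ} {k₀ : K}

/-- The completeness relation `sum_mul` read as an operator identity. It puts the swap in the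
algebra generated by the `V ⊗ V` and evaluates the cross terms in `sum_integral_quad_gen`. -/
theorem sum_kronecker (hσ : IsHermitianUnitaryBasis σ k₀) :
    ∑ k, σ k ⊗ₖ σ k = (Fintype.card n : ℂ) • swapMatrix n := by
  ext i j
  simp [Matrix.sum_apply, hσ.sum_mul, swapMatrix, eq_comm]

theorem card_smul_eq_sum (hσ : IsHermitianUnitaryBasis σ k₀) (A : Matrix n n ℂ) :
    (Fintype.card n : ℂ) • A = ∑ k, (σ k * A).trace • σ k := by
  ext i j
  have h (k) : (σ k * A).trace * σ k i j = ∑ a, ∑ b, A b a * (σ k a b * σ k i j) := by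
    simp only [Matrix.trace, Matrix.diag, Matrix.mul_apply, Finset.sum_mul]
    refine Finset.sum_congr rfl fun _ _ => Finset.sum_congr rfl fun _ _ => by ring
  simp only [Matrix.sum_apply, Matrix.smul_apply, smul_eq_mul, h]
  rw [Finset.sum_comm, Finset.sum_eq_single j]
  · rw [Finset.sum_comm, Finset.sum_eq_single i]
    · simp [← Finset.mul_sum, hσ.sum_mul, mul_comm]
    · intro b _ hb; simp [← Finset.mul_sum, hσ.sum_mul, hb]
    · simp
  · intro a _ ha
    rw [Finset.sum_comm]
    simp [← Finset.mul_sum, hσ.sum_mul, ha]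
  · simp

theorem trace_eq (hσ : IsHermitianUnitaryBasis σ k₀) (k : K) :
    (σ k).trace = if k = k₀ then (Fintype.card n : ℂ) else 0 := by
  rw [← hσ.trace_mul k k₀, hσ.eq_one, mul_one]

theorem card_eq [Nonempty n] (hσ : IsHermitianUnitaryBasis σ k₀) :
    (Fintype.card K : ℝ) = (Fintype.card n : ℝ) ^ 2 := by
  have h1 : ∑ k, (σ k * σ k).trace = Fintype.card K * Fintype.card n := by
    simp [hσ.trace_mul]
  have h2 : ∑ k, (σ k * σ k).trace = (Fintype.card n : ℂ) ^ 2 * Fintype.card n := by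
    simp only [Matrix.trace, Matrix.diag, Matrix.mul_apply]
    rw [Finset.sum_comm]
    simp_rw [Finset.sum_comm (s := (Finset.univ : Finset K)), hσ.sum_mul]
    simp
    ring
  have h3 : (Fintype.card n : ℂ) ≠ 0 := by simp
  exact_mod_cast mul_right_cancel₀ h3 (h1.symm.trans h2)

theorem mem_unitaryGroup (hσ : IsHermitianUnitaryBasis σ k₀) (k : K) :
    σ k ∈ Matrix.unitaryGroup n ℂ := by
  rw [Matrix.mem_unitaryGroup_iff, Matrix.star_eq_conjTranspose, hσ.isHermitian, hσ.mul_self]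

theorem sum_mul_mul_conjTranspose (hσ : IsHermitianUnitaryBasis σ k₀) {U : Matrix n n ℂ}
    (hU : U ∈ Matrix.unitaryGroup n ℂ) (a b c e : n) :
    ∑ k, (σ k * U) a b * star ((σ k * U) c e) =
      if a = c ∧ b = e then (Fintype.card n : ℂ) else 0 := by
  have hconj (k x y) : star (σ k x y) = σ k y x := by
    rw [← Matrix.conjTranspose_apply, hσ.isHermitian]
  have h (k) : (σ k * U) a b * star ((σ k * U) c e) =
      ∑ x, ∑ y, U x b * star (U y e) * (σ k a x * σ k y c) := by
    simp only [Matrix.mul_apply, star_sum, star_mul', hconj, Finset.sum_mul_sum]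
    refine Finset.sum_congr rfl fun _ _ => Finset.sum_congr rfl fun _ _ => by ring
  have hU' : ∑ x, star (U x e) * U x b = if e = b then 1 else 0 := by
    have := congrFun (congrFun (Matrix.mem_unitaryGroup_iff'.1 hU) e) b
    simpa [Matrix.mul_apply, Matrix.one_apply] using this
  simp only [h]
  rw [Finset.sum_comm]
  simp_rw [Finset.sum_comm (s := (Finset.univ : Finset K)), ← Finset.mul_sum, hσ.sum_mul]
  by_cases hac : a = c
  · simp only [hac, true_and, mul_ite, mul_zero, Finset.sum_ite_eq, Finset.mem_univ, if_true,
      mul_comm (U _ b), ← Finset.sum_mul, hU', eq_comm (a := b)]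
    split_ifs <;> simp
  · simp [hac]

end IsHermitianUnitaryBasis

/-! ### Quarter turns and their tensor squares -/

/-- The rotations `(1 ± i P) / √2` generated by a Hermitian unitary `P`. -/
noncomputable def quarterTurn {n : Type*} [DecidableEq n] (P : Matrix n n ℂ) (ε : ℂ) :
    Matrix n n ℂ :=
  ((Real.sqrt 2 : ℝ) : ℂ)⁻¹ • (1 + ε • P)

theorem inv_sqrt_two_mul_self :
    ((Real.sqrt 2 : ℝ) : ℂ)⁻¹ * ((Real.sqrt 2 : ℝ) : ℂ)⁻¹ = 2⁻¹ := by
  rw [← mul_inv, ← Complex.ofReal_mul, Real.mul_self_sqrt (by norm_num)]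
  simp

section QuarterTurn

variable {n : Type*} [DecidableEq n] {P : Matrix n n ℂ}

theorem quarterTurn_mul_quarterTurn [Fintype n] (hP : P * P = 1) {ε : ℂ} (hε : ε * ε = -1) :
    quarterTurn P ε * quarterTurn P (-ε) = 1 := by
  rw [quarterTurn, quarterTurn, smul_mul_smul_comm, inv_sqrt_two_mul_self]
  simp only [mul_add, add_mul, mul_one, one_mul, smul_mul_smul_comm, hP, mul_neg, hε,
    one_smul, neg_smul]
  rw [show (1 : Matrix n n ℂ) + ε • P + -(ε • P + -1) = (2 : ℂ) • 1 by rw [two_smul]; abel,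
    smul_smul]
  simp

theorem conjTranspose_quarterTurn (hP : Pᴴ = P) {ε : ℂ} (hε : star ε = -ε) :
    (quarterTurn P ε)ᴴ = quarterTurn P (-ε) := by
  simp only [quarterTurn, Matrix.conjTranspose_smul, Matrix.conjTranspose_add,
    Matrix.conjTranspose_one, hP, hε]
  simp

theorem quarterTurn_mem_unitaryGroup [Fintype n] (hP : Pᴴ = P) (hP' : P * P = 1) {ε : ℂ}
    (hε : ε * ε = -1) (hε' : star ε = -ε) : quarterTurn P ε ∈ Matrix.unitaryGroup n ℂ := by
  rw [Matrix.mem_unitaryGroup_iff, Matrix.star_eq_conjTranspose, conjTranspose_quarterTurn hP hε',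
    quarterTurn_mul_quarterTurn hP' hε]

theorem quarterTurn_kronecker_quarterTurn {ε : ℂ} (hε : ε * ε = -1) :
    quarterTurn P ε ⊗ₖ quarterTurn P ε =
      (2 : ℂ)⁻¹ • ((1 - P ⊗ₖ P) + ε • (P ⊗ₖ 1 + 1 ⊗ₖ P)) := by
  rw [quarterTurn, Matrix.smul_kronecker, Matrix.kronecker_smul, smul_smul, inv_sqrt_two_mul_self,
    Matrix.add_kronecker, Matrix.kronecker_add, Matrix.kronecker_add, Matrix.one_kronecker_one,
    Matrix.smul_kronecker, Matrix.smul_kronecker, Matrix.kronecker_smul, Matrix.kronecker_smul,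
    smul_smul, hε]
  congr 1
  rw [neg_smul, one_smul, smul_add]
  abel

end QuarterTurn

/-! ### The sesquilinear form of a positive operator -/

section Form

variable {κ : Type*} [Fintype κ]

/-- The quadratic form of a matrix. -/
noncomputable def quad (ρ : Matrix κ κ ℂ) (v : κ → ℂ) : ℝ := (star v ⬝ᵥ ρ *ᵥ v).re

theorem quad_nonneg {ρ : Matrix κ κ ℂ} (hρ : ρ.PosSemidef) (v : κ → ℂ) : 0 ≤ quad ρ v :=
  (Complex.le_def.1 (hρ.dotProduct_mulVec_nonneg v)).1

theorem quad_smul (ρ : Matrix κ κ ℂ) (c : ℂ) (v : κ → ℂ) :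
    quad ρ (c • v) = Complex.normSq c * quad ρ v := by
  have h : star (c • v) ⬝ᵥ ρ *ᵥ (c • v) = (Complex.normSq c : ℂ) * (star v ⬝ᵥ ρ *ᵥ v) := by
    rw [Matrix.mulVec_smul, star_smul, smul_dotProduct, dotProduct_smul, smul_smul,
      Complex.normSq_eq_conj_mul_self, smul_eq_mul]
    rfl
  rw [quad, h, Complex.re_ofReal_mul, quad]

theorem quad_add_quad_sub (ρ : Matrix κ κ ℂ) (v w : κ → ℂ) :
    quad ρ (v + w) + quad ρ (v - w) = 2 * quad ρ v + 2 * quad ρ w := by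
  simp only [quad, Matrix.mulVec_add, Matrix.mulVec_sub, star_add, star_sub, add_dotProduct,
    sub_dotProduct, dotProduct_add, dotProduct_sub, Complex.add_re, Complex.sub_re]
  ring

theorem quad_sub {ρ : Matrix κ κ ℂ} (hρ : ρ.IsHermitian) (v w : κ → ℂ) :
    quad ρ (v - w) = quad ρ v + quad ρ w - 2 * (star v ⬝ᵥ ρ *ᵥ w).re := by
  have h : (star w ⬝ᵥ ρ *ᵥ v).re = (star v ⬝ᵥ ρ *ᵥ w).re := by
    have h' : star w ⬝ᵥ ρ *ᵥ v = star (star v ⬝ᵥ ρ *ᵥ w) := by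
      rw [← Matrix.star_dotProduct_star, star_star, Matrix.star_mulVec, hρ.eq,
        Matrix.dotProduct_mulVec, dotProduct_comm]
    rw [h']; rfl
  simp only [quad, Matrix.mulVec_sub, star_sub, sub_dotProduct, dotProduct_sub, Complex.sub_re, h]
  ring

theorem quad_add_le {ρ : Matrix κ κ ℂ} (hρ : ρ.PosSemidef) (v w : κ → ℂ) {η : ℝ} (hη : 0 < η) :
    quad ρ (v + w) ≤ (1 + η) * quad ρ v + (1 + η⁻¹) * quad ρ w := by
  -- Expanding this form and dividing by `η` bounds the cross term: the weighted
  -- arithmetic-geometric mean inequality.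
  have h0 := quad_nonneg hρ ((η : ℂ) • v - w)
  have h1 := quad_sub hρ.1 ((η : ℂ) • v) w
  have h2 := quad_sub hρ.1 v w
  have h3 := quad_add_quad_sub ρ v w
  have h4 : (star ((η : ℂ) • v) ⬝ᵥ ρ *ᵥ w).re = η * (star v ⬝ᵥ ρ *ᵥ w).re := by
    rw [star_smul, smul_dotProduct]
    simp
  rw [quad_smul, Complex.normSq_ofReal, h4] at h1
  have h5 : 2 * (star v ⬝ᵥ ρ *ᵥ w).re ≤ η * quad ρ v + η⁻¹ * quad ρ w := by
    have h6 : 0 ≤ η⁻¹ * (η * η * quad ρ v + quad ρ w - 2 * (η * (star v ⬝ᵥ ρ *ᵥ w).re)) :=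
      mul_nonneg (inv_pos.2 hη).le (by linarith)
    have h7 : η⁻¹ * (η * η * quad ρ v + quad ρ w - 2 * (η * (star v ⬝ᵥ ρ *ᵥ w).re)) =
        η * quad ρ v + η⁻¹ * quad ρ w - 2 * (star v ⬝ᵥ ρ *ᵥ w).re := by
      field_simp
    linarith
  linarith

theorem trace_mul_nonneg_of_idempotent [DecidableEq κ] {ρ E : Matrix κ κ ℂ} (hρ : ρ.PosSemidef)
    (hE : Eᴴ = E) (hE' : E * E = E) : 0 ≤ (ρ * E).trace.re := by
  have h := (hρ.conjTranspose_mul_mul_same E).trace_nonneg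
  rw [hE, Matrix.mul_assoc, Matrix.trace_mul_comm, Matrix.mul_assoc, hE'] at h
  exact (Complex.le_def.1 h).1

/-- **Bessel's inequality** for an orthogonal family in the range of a projection. -/
theorem sum_quad_div_le_trace_mul [DecidableEq κ] {ι : Type*} [Fintype ι] [DecidableEq ι]
    {ρ P : Matrix κ κ ℂ} (hρ : ρ.PosSemidef) (hP : Pᴴ = P) (hP' : P * P = P) {v : ι → κ → ℂ}
    {c : ι → ℝ} (hc : ∀ i, 0 < c i)
    (hv : ∀ i j, star (v i) ⬝ᵥ v j = if i = j then (c i : ℂ) else 0)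
    (hPv : ∀ i, P *ᵥ v i = v i) :
    ∑ i, quad ρ (v i) / c i ≤ (ρ * P).trace.re := by
  -- The orthogonal projection onto the span of the family. It lies below `P`, so `P - E` is again a
  -- projection and pairs nonnegatively with `ρ`.
  let E : Matrix κ κ ℂ := ∑ i, ((c i : ℂ)⁻¹) • Matrix.vecMulVec (v i) (star (v i))
  have hE : Eᴴ = E := by
    simp [E, Matrix.conjTranspose_sum, Matrix.conjTranspose_smul, Matrix.conjTranspose_vecMulVec]
  have hPE : P * E = E := by
    simp [E, Matrix.mul_sum, Matrix.mul_vecMulVec, hPv]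
  have hEP : E * P = E := by
    have := congrArg Matrix.conjTranspose hPE
    rwa [Matrix.conjTranspose_mul, hP, hE] at this
  have hEE : E * E = E := by
    simp only [E, Finset.sum_mul_sum, smul_mul_smul_comm, Matrix.vecMulVec_mul_vecMulVec, hv]
    refine Finset.sum_congr rfl fun i _ => ?_
    have hci : (c i : ℂ) ≠ 0 := by exact_mod_cast (hc i).ne'
    rw [Finset.sum_eq_single i]
    · ext a b
      simp [Matrix.vecMulVec_apply]
      field_simp
    · intro j _ hj; ext a b; simp [hj.symm]
    · simp
  have htr : (ρ * E).trace.re = ∑ i, quad ρ (v i) / c i := by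
    simp only [E, Matrix.mul_sum, Matrix.trace_sum, Complex.re_sum, mul_smul_comm,
      Matrix.trace_smul, Matrix.mul_vecMulVec, Matrix.trace_vecMulVec]
    refine Finset.sum_congr rfl fun i _ => ?_
    rw [smul_eq_mul, ← Complex.ofReal_inv, Complex.re_ofReal_mul, dotProduct_comm, quad]
    field_simp
  have h := trace_mul_nonneg_of_idempotent hρ (E := P - E)
    (by rw [Matrix.conjTranspose_sub, hP, hE])
    (by rw [sub_mul, mul_sub, mul_sub, hP', hPE, hEP, hEE]; abel)
  rw [mul_sub, Matrix.trace_sub, Complex.sub_re, htr] at h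
  linarith

end Form

/-! ### Operators on two copies, as vectors -/

section SymOp

variable {n : Type*} [Fintype n] [DecidableEq n]

/-- The restriction of `U ⊗ U` to the symmetric or antisymmetric subspace. -/
noncomputable def symOp (s : ℝ) (U : Matrix n n ℂ) : Matrix (n × n) (n × n) ℂ :=
  (U ⊗ₖ U) * symProj n s

theorem kronecker_mul_symOp (s : ℝ) (V U : Matrix n n ℂ) :
    (V ⊗ₖ V) * symOp s U = symOp s (V * U) := by
  rw [symOp, symOp, ← mul_assoc, Matrix.mul_kronecker_mul]

theorem symProj_mul_symOp {s : ℝ} (hs : s ^ 2 = 1) (U : Matrix n n ℂ) :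
    symProj n s * symOp s U = symOp s U := by
  rw [symOp, ← mul_assoc, symProj_mul_kronecker_self, mul_assoc, symProj_mul_self hs]

theorem symOp_mul_symProj {s : ℝ} (hs : s ^ 2 = 1) (U : Matrix n n ℂ) :
    symOp s U * symProj n s = symOp s U := by
  rw [symOp, mul_assoc, symProj_mul_self hs]

theorem swapMatrix_mul_symOp {s : ℝ} (hs : s ^ 2 = 1) (U : Matrix n n ℂ) :
    swapMatrix n * symOp s U = (s : ℂ) • symOp s U := by
  rw [symOp, ← mul_assoc, swapMatrix_mul_kronecker, mul_assoc, swapMatrix_mul_symProj hs,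
    mul_smul_comm]

theorem symOp_mul_conjTranspose {s : ℝ} (hs : s ^ 2 = 1) {U : Matrix n n ℂ}
    (hU : U ∈ Matrix.unitaryGroup n ℂ) : symOp s U * (symOp s U)ᴴ = symProj n s := by
  have h : U * Uᴴ = 1 := Matrix.mem_unitaryGroup_iff.1 hU
  rw [symOp, Matrix.conjTranspose_mul, conjTranspose_symProj, mul_assoc, ← mul_assoc (symProj n s),
    symProj_mul_self hs, Matrix.conjTranspose_kronecker, symProj_mul_kronecker_self, ← mul_assoc,
    ← Matrix.mul_kronecker_mul, h, Matrix.one_kronecker_one, one_mul]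

theorem conjTranspose_symOp_mul {s : ℝ} (hs : s ^ 2 = 1) {U : Matrix n n ℂ}
    (hU : U ∈ Matrix.unitaryGroup n ℂ) : (symOp s U)ᴴ * symOp s U = symProj n s := by
  have h : Uᴴ * U = 1 := Matrix.mem_unitaryGroup_iff'.1 hU
  rw [symOp, Matrix.conjTranspose_mul, conjTranspose_symProj, mul_assoc,
    ← mul_assoc _ (U ⊗ₖ U), Matrix.conjTranspose_kronecker, ← Matrix.mul_kronecker_mul, h,
    Matrix.one_kronecker_one, one_mul, symProj_mul_self hs]

theorem star_vec_mul_symOp_dotProduct {s : ℝ} (hs : s ^ 2 = 1) {U : Matrix n n ℂ}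
    (hU : U ∈ Matrix.unitaryGroup n ℂ) (A B : Matrix (n × n) (n × n) ℂ) :
    star (A * symOp s U).vec ⬝ᵥ (B * symOp s U).vec = (Aᴴ * B * symProj n s).trace := by
  rw [Matrix.star_vec_dotProduct_vec, Matrix.conjTranspose_mul, mul_assoc, Matrix.trace_mul_comm,
    mul_assoc, mul_assoc, symOp_mul_conjTranspose hs hU, ← mul_assoc]

/-- The operator on two copies of inputs and outputs that projects both of them. -/
noncomputable def symProjBoth (n : Type*) [Fintype n] [DecidableEq n] (s : ℝ) :
    Matrix ((n × n) × (n × n)) ((n × n) × (n × n)) ℂ :=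
  (symProj n s)ᵀ ⊗ₖ symProj n s

theorem conjTranspose_transpose_symProj {m : Type*} [DecidableEq m] (s : ℝ) :
    ((symProj m s)ᵀ)ᴴ = (symProj m s)ᵀ := by
  change ((symProj m s)ᴴ)ᵀ = _
  rw [conjTranspose_symProj]

theorem conjTranspose_symProjBoth (s : ℝ) : (symProjBoth n s)ᴴ = symProjBoth n s := by
  rw [symProjBoth, Matrix.conjTranspose_kronecker, conjTranspose_transpose_symProj,
    conjTranspose_symProj]

theorem symProjBoth_mul_self {s : ℝ} (hs : s ^ 2 = 1) :
    symProjBoth n s * symProjBoth n s = symProjBoth n s := by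
  rw [symProjBoth, ← Matrix.mul_kronecker_mul, ← Matrix.transpose_mul, symProj_mul_self hs]

theorem symProjBoth_mulVec (s : ℝ) (X : Matrix (n × n) (n × n) ℂ) :
    symProjBoth n s *ᵥ X.vec = (symProj n s * X * symProj n s).vec := by
  rw [symProjBoth, Matrix.kronecker_mulVec_vec, Matrix.transpose_transpose]

/-- If the marginal on the inputs is maximally mixed, the weight on the symmetric
(antisymmetric) subspace is at most the relative dimension of that subspace. -/
theorem trace_mul_symProjBoth_le {s : ℝ} (hs : s ^ 2 = 1)
    {ρ : Matrix ((n × n) × (n × n)) ((n × n) × (n × n)) ℂ} (hρ : ρ.PosSemidef) {c : ℝ}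
    (hmarg : ∀ j j', ∑ i, ρ (j, i) (j', i) = if j = j' then (c : ℂ) else 0) :
    (ρ * symProjBoth n s).trace.re ≤
      c * (2⁻¹ * (Fintype.card n * (Fintype.card n + s))) := by
  -- Dropping the projection on the outputs only increases the weight; what remains depends on the
  -- input marginal alone.
  have h := trace_mul_nonneg_of_idempotent hρ (E := (symProj n s)ᵀ ⊗ₖ (1 - symProj n s))
    (by rw [Matrix.conjTranspose_kronecker, conjTranspose_transpose_symProj,
      Matrix.conjTranspose_sub, conjTranspose_symProj, Matrix.conjTranspose_one])
    (by
      rw [← Matrix.mul_kronecker_mul, ← Matrix.transpose_mul, symProj_mul_self hs]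
      congr 1
      rw [sub_mul, mul_sub, mul_sub, symProj_mul_self hs]
      simp)
  have hone : (ρ * ((symProj n s)ᵀ ⊗ₖ (1 : Matrix (n × n) (n × n) ℂ))).trace =
      ((c * (2⁻¹ * (Fintype.card n * (Fintype.card n + s))) : ℝ) : ℂ) := by
    have h1 : (ρ * ((symProj n s)ᵀ ⊗ₖ (1 : Matrix (n × n) (n × n) ℂ))).trace =
        ∑ j, ∑ j', (∑ i, ρ (j, i) (j', i)) * symProj n s j j' := by
      simp only [Matrix.trace, Matrix.diag, Matrix.mul_apply, Fintype.sum_prod_type (γ := ℂ)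
        (α₁ := n × n) (α₂ := n × n), Matrix.kroneckerMap_apply, Matrix.transpose_apply,
        Matrix.one_apply, mul_ite, mul_one, mul_zero, Finset.sum_ite_eq', Finset.mem_univ, if_true,
        Finset.sum_mul]
      refine Finset.sum_congr rfl fun j _ => ?_
      rw [Finset.sum_comm]
    have h2 := trace_symProj (n := n) s
    simp only [Matrix.trace, Matrix.diag] at h2
    rw [h1]
    simp only [hmarg, ite_mul, zero_mul, Finset.sum_ite_eq, Finset.mem_univ, if_true,
      ← Finset.mul_sum, h2]
    push_cast
    rfl
  have hsub : (symProj n s)ᵀ ⊗ₖ (1 - symProj n s) =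
      (symProj n s)ᵀ ⊗ₖ 1 - (symProj n s)ᵀ ⊗ₖ symProj n s := by
    rw [eq_sub_iff_add_eq, ← Matrix.kronecker_add, sub_add_cancel]
  rw [hsub, mul_sub, Matrix.trace_sub, hone, Complex.sub_re,
    Complex.ofReal_re] at h
  rw [symProjBoth]
  linarith

/-- Bessel's inequality for a single vector, whose squared norm is the dimension of the subspace.
The estimate is good enough only when that dimension is `1`. -/
theorem quad_vec_symOp_le {s : ℝ} (hs : s ^ 2 = 1) {U : Matrix n n ℂ}
    (hU : U ∈ Matrix.unitaryGroup n ℂ)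
    {ρ : Matrix ((n × n) × (n × n)) ((n × n) × (n × n)) ℂ} (hρ : ρ.PosSemidef)
    (hd : 0 < (2 : ℝ)⁻¹ * (Fintype.card n * (Fintype.card n + s))) :
    quad ρ (symOp s U).vec ≤
      2⁻¹ * (Fintype.card n * (Fintype.card n + s)) * (ρ * symProjBoth n s).trace.re := by
  have h := sum_quad_div_le_trace_mul (ι := Unit) hρ (conjTranspose_symProjBoth s)
    (symProjBoth_mul_self hs) (v := fun _ => (symOp s U).vec) (fun _ => hd)
    (fun _ _ => by
      rw [Matrix.star_vec_dotProduct_vec, conjTranspose_symOp_mul hs hU, trace_symProj]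
      simp)
    (fun _ => by
      rw [symProjBoth_mulVec, symProj_mul_symOp hs, symOp_mul_symProj hs])
  simp only [Finset.univ_unique, Finset.sum_const, Finset.card_singleton, one_smul] at h
  rw [div_le_iff₀ hd] at h
  linarith

/-- The generator of `V ↦ V ⊗ V`. -/
noncomputable def gen (P : Matrix n n ℂ) : Matrix (n × n) (n × n) ℂ := P ⊗ₖ 1 + 1 ⊗ₖ P

theorem gen_mul_gen (A B : Matrix n n ℂ) :
    gen A * gen B = gen (A * B) + (A ⊗ₖ B + B ⊗ₖ A) := by
  simp only [gen, add_mul, mul_add, ← Matrix.mul_kronecker_mul, mul_one, one_mul]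
  abel

theorem symProj_mul_gen (s : ℝ) (A : Matrix n n ℂ) :
    symProj n s * gen A = gen A * symProj n s := by
  simp only [gen, symProj, smul_mul_assoc, mul_smul_comm, add_mul, mul_add, one_mul, mul_one,
    swapMatrix_mul_kronecker]
  simp only [smul_add]
  abel

/-- Since `symOp s U` is a partial isometry, inner products of the tangent vectors are traces of
`gen (σ k) * gen (σ l)` against `symProj n s`. Trace orthogonality kills them for `k ≠ l`; the
identity element alone has the extra squared norm `d²`. -/
theorem sum_quad_gen_le {K : Type*} [Fintype K] [DecidableEq K]
    {σ : K → Matrix n n ℂ} {k₀ : K} (hσ : IsHermitianUnitaryBasis σ k₀)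
    {s : ℝ} (hs : s ^ 2 = 1) {U : Matrix n n ℂ} (hU : U ∈ Matrix.unitaryGroup n ℂ)
    {ρ : Matrix ((n × n) × (n × n)) ((n × n) × (n × n)) ℂ} (hρ : ρ.PosSemidef)
    (hd : 0 < (Fintype.card n * (Fintype.card n + 2 * s) : ℝ)) :
    ∑ k, quad ρ (gen (σ k) * symOp s U).vec /
        (Fintype.card n * (Fintype.card n + 2 * s) + if k = k₀ then (Fintype.card n : ℝ) ^ 2 else 0)
      ≤ (ρ * symProjBoth n s).trace.re := by
  refine sum_quad_div_le_trace_mul hρ (conjTranspose_symProjBoth s) (symProjBoth_mul_self hs)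
    (fun k => ?_) (fun k l => ?_) (fun k => ?_)
  · split_ifs <;> positivity
  · have hgen : (gen (σ k))ᴴ = gen (σ k) := by
      simp [gen, Matrix.conjTranspose_add, Matrix.conjTranspose_kronecker, hσ.isHermitian]
    rw [star_vec_mul_symOp_dotProduct hs hU, hgen, gen_mul_gen, gen, add_mul, add_mul, add_mul,
      Matrix.trace_add, Matrix.trace_add, Matrix.trace_add]
    simp only [trace_kronecker_mul_symProj, Matrix.trace_one, mul_one, one_mul, hσ.trace_eq,
      hσ.trace_mul]
    by_cases hkl : k = l
    · subst hkl
      by_cases hk : k = k₀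
      · simp [hk]; ring
      · simp [hk]; ring
    · by_cases hk : k = k₀
      · have hl : l ≠ k₀ := fun h => hkl (hk.trans h.symm)
        simp [hkl, hl, Ne.symm hkl]
      · simp [hkl, hk, Ne.symm hkl]
  · rw [symProjBoth_mulVec, ← mul_assoc, symProj_mul_gen, mul_assoc, mul_assoc,
      symOp_mul_symProj hs, symProj_mul_symOp hs]

/-- The tensor squares of the two rotations differ only in the sign of `i • gen P`, so the
parallelogram law removes the terms mixing it with `1 - P ⊗ P`. -/
theorem quad_quarterTurn_add {P : Matrix n n ℂ} {ρ : Matrix ((n × n) × (n × n)) _ ℂ}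
    (hρ : ρ.IsHermitian) (X : Matrix (n × n) (n × n) ℂ) :
    quad ρ ((quarterTurn P Complex.I ⊗ₖ quarterTurn P Complex.I) * X).vec +
        quad ρ ((quarterTurn P (-Complex.I) ⊗ₖ quarterTurn P (-Complex.I)) * X).vec =
      2⁻¹ * (quad ρ X.vec + quad ρ ((P ⊗ₖ P) * X).vec -
        2 * (star X.vec ⬝ᵥ ρ *ᵥ ((P ⊗ₖ P) * X).vec).re + quad ρ (gen P * X).vec) := by
  rw [quarterTurn_kronecker_quarterTurn Complex.I_mul_I,
    quarterTurn_kronecker_quarterTurn (by simp), ← gen]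
  simp only [smul_mul_assoc, Matrix.vec_smul, quad_smul, add_mul, sub_mul, one_mul,
    Matrix.vec_add, Matrix.vec_sub, neg_smul, ← sub_eq_add_neg]
  rw [← mul_add, quad_add_quad_sub, quad_smul, quad_sub hρ]
  simp
  ring

end SymOp

/-! ### The Haar measure of the unitary group -/

section Haar

variable (n : Type*) [Fintype n] [DecidableEq n]

instance : CompactSpace (Matrix.unitaryGroup n ℂ) := by
  have hsub : (Matrix.unitaryGroup n ℂ : Set (Matrix n n ℂ)) ⊆
      Set.univ.pi fun _ : n => Set.univ.pi fun _ : n => Metric.closedBall (0 : ℂ) 1 := by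
    intro U hU i _ j _
    simpa using entry_norm_bound_of_unitary hU i j
  have hclosed : IsClosed (Matrix.unitaryGroup n ℂ : Set (Matrix n n ℂ)) := by
    have h : (Matrix.unitaryGroup n ℂ : Set (Matrix n n ℂ)) = {U | U * star U = 1} := by
      ext U
      exact Matrix.mem_unitaryGroup_iff
    rw [h]
    exact isClosed_eq (continuous_id.matrix_mul continuous_id.matrix_conjTranspose)
      continuous_const
  exact isCompact_iff_compactSpace.1 (IsCompact.of_isClosed_subset
    (isCompact_univ_pi fun _ => isCompact_univ_pi fun _ => isCompact_closedBall 0 1) hclosed hsub)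

noncomputable instance : MeasurableSpace (Matrix.unitaryGroup n ℂ) := borel _

instance : BorelSpace (Matrix.unitaryGroup n ℂ) := ⟨rfl⟩

/-- The normalized Haar measure of the unitary group. -/
noncomputable def haarUnitary : Measure (Matrix.unitaryGroup n ℂ) := Measure.haarMeasure ⊤

instance : (haarUnitary n).IsHaarMeasure := Measure.isHaarMeasure_haarMeasure _

instance : IsProbabilityMeasure (haarUnitary n) := ⟨Measure.haarMeasure_self⟩

end Haar

section Average

variable {n : Type*} [Fintype n] [DecidableEq n]

theorem _root_.Continuous.integrable_haarUnitary {E : Type*} [NormedAddCommGroup E]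
    {f : Matrix.unitaryGroup n ℂ → E} (hf : Continuous f) : Integrable f (haarUnitary n) :=
  hf.integrable_of_hasCompactSupport (HasCompactSupport.of_compactSpace f)

theorem integral_haarUnitary_mul_left {E : Type*} [NormedAddCommGroup E] [NormedSpace ℝ E]
    (V : Matrix.unitaryGroup n ℂ) (f : Matrix.unitaryGroup n ℂ → E) :
    ∫ U, f (V * U) ∂haarUnitary n = ∫ U, f U ∂haarUnitary n :=
  integral_mul_left_eq_self f V

theorem continuous_vec_symOp (s : ℝ) :
    Continuous fun U : Matrix.unitaryGroup n ℂ => (symOp s U.1).vec := by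
  have h : Continuous fun U : Matrix.unitaryGroup n ℂ => symOp s U.1 := by
    refine Continuous.matrix_mul (continuous_matrix fun i j => ?_) continuous_const
    exact (continuous_subtype_val.matrix_elem _ _).mul (continuous_subtype_val.matrix_elem _ _)
  exact continuous_pi fun i => h.matrix_elem _ _

/-! ### The average of `|U ⊗ U⟩⟨U ⊗ U|` on the symmetric and antisymmetric subspaces -/

/-- The elements of an algebra that may be moved cyclically inside a linear functional. -/
def centralizerOf {A : Type*} [Ring A] [Algebra ℂ A] (Λ : A →ₗ[ℂ] ℂ) : Subalgebra ℂ A where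
  carrier := {a | ∀ b, Λ (b * a) = Λ (a * b)}
  mul_mem' {a a'} ha ha' b := by rw [← mul_assoc, ha', ← mul_assoc, ha, mul_assoc]
  add_mem' {a a'} ha ha' b := by simp only [mul_add, add_mul, map_add, ha b, ha' b]
  algebraMap_mem' c b := by rw [Algebra.commutes]

/-- A concrete form of Schur-Weyl duality: the operators `V ⊗ V` generate every operator supported
on the symmetric or on the antisymmetric subspace. -/
theorem symProj_mul_mul_symProj_mem [Nonempty n] {K : Type*} [Fintype K] [DecidableEq K]
    {σ : K → Matrix n n ℂ} {k₀ : K} (hσ : IsHermitianUnitaryBasis σ k₀)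
    {s : ℝ} (hs : s ^ 2 = 1) {𝒜 : Subalgebra ℂ (Matrix (n × n) (n × n) ℂ)}
    (h𝒜 : ∀ V ∈ Matrix.unitaryGroup n ℂ, V ⊗ₖ V ∈ 𝒜) (M : Matrix (n × n) (n × n) ℂ) :
    symProj n s * M * symProj n s ∈ 𝒜 := by
  have hcard : (Fintype.card n : ℂ) ≠ 0 := by simp
  -- The difference of the tensor squares of the two quarter turns is `i • gen (σ k)`; no derivative
  -- at the identity is needed.
  have hgenσ (k) : gen (σ k) ∈ 𝒜 := by
    have h1 := h𝒜 _ (quarterTurn_mem_unitaryGroup (hσ.isHermitian k) (hσ.mul_self k)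
      Complex.I_mul_I (by simp))
    have h2 := h𝒜 _ (quarterTurn_mem_unitaryGroup (hσ.isHermitian k) (hσ.mul_self k)
      (ε := -Complex.I) (by simp) (by simp))
    rw [quarterTurn_kronecker_quarterTurn Complex.I_mul_I, ← gen] at h1
    rw [quarterTurn_kronecker_quarterTurn (by simp), ← gen] at h2
    have h3 := 𝒜.smul_mem (𝒜.sub_mem h1 h2) (-Complex.I)
    convert h3 using 1
    rw [← smul_sub, add_sub_add_left_eq_sub, ← sub_smul, smul_smul, smul_smul,
      show -Complex.I * 2⁻¹ * (Complex.I - -Complex.I) = -(Complex.I * Complex.I) by ring,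
      Complex.I_mul_I, neg_neg, one_smul]
  have hgen (A : Matrix n n ℂ) : gen A ∈ 𝒜 := by
    have h1 : A = (Fintype.card n : ℂ)⁻¹ • ∑ k, (σ k * A).trace • σ k := by
      rw [← hσ.card_smul_eq_sum, smul_smul, inv_mul_cancel₀ hcard, one_smul]
    have h2 : gen A = (Fintype.card n : ℂ)⁻¹ • ∑ k, (σ k * A).trace • gen (σ k) := by
      conv_lhs => rw [h1]
      ext i j
      simp only [gen, Matrix.add_apply, Matrix.kroneckerMap_apply, Matrix.smul_apply,
        Matrix.sum_apply, smul_eq_mul, Finset.mul_sum, Finset.sum_mul, ← Finset.sum_add_distrib]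
      refine Finset.sum_congr rfl fun k _ => by ring
    rw [h2]
    exact 𝒜.smul_mem (𝒜.sum_mem fun k _ => 𝒜.smul_mem (hgenσ k) _) _
  have hsym (A B : Matrix n n ℂ) : A ⊗ₖ B + B ⊗ₖ A ∈ 𝒜 := by
    rw [← add_sub_cancel_left (gen (A * B)) (A ⊗ₖ B + B ⊗ₖ A), ← gen_mul_gen]
    exact 𝒜.sub_mem (𝒜.mul_mem (hgen A) (hgen B)) (hgen _)
  have hσσ (k) : σ k ⊗ₖ σ k ∈ 𝒜 := h𝒜 _ (hσ.mem_unitaryGroup k)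
  have hswap : swapMatrix n ∈ 𝒜 := by
    have h1 : swapMatrix n = (Fintype.card n : ℂ)⁻¹ • ∑ k, σ k ⊗ₖ σ k := by
      rw [hσ.sum_kronecker, smul_smul, inv_mul_cancel₀ hcard, one_smul]
    rw [h1]
    exact 𝒜.smul_mem (𝒜.sum_mem fun k _ => hσσ k) _
  have hproj : symProj n s ∈ 𝒜 :=
    𝒜.smul_mem (𝒜.add_mem 𝒜.one_mem (𝒜.smul_mem hswap _)) _
  have hM : M = ∑ i, ∑ j, M i j • (Matrix.single i.1 j.1 1 ⊗ₖ Matrix.single i.2 j.2 1) := by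
    conv_lhs => rw [Matrix.matrix_eq_sum_single M]
    refine Finset.sum_congr rfl fun i _ => Finset.sum_congr rfl fun j _ => ?_
    rw [Matrix.single_kronecker_single, Matrix.smul_single]
    simp
  rw [hM]
  simp only [Matrix.mul_sum, Matrix.sum_mul, mul_smul_comm, smul_mul_assoc,
    symProj_mul_kronecker_mul_symProj hs]
  exact 𝒜.sum_mem fun i _ => 𝒜.sum_mem fun j _ =>
    𝒜.smul_mem (𝒜.smul_mem (𝒜.mul_mem hproj (hsym _ _)) _) _

/-! ### Matrix units and operators on the second factor -/

section Index

variable {m : Type*} [Fintype m] [DecidableEq m]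

theorem sum_single_mul_mul_single (M : Matrix m m ℂ) :
    ∑ a, ∑ b, Matrix.single a b (1 : ℂ) * M * Matrix.single b a 1 = M.trace • 1 := by
  ext i j
  simp only [Matrix.sum_apply, Matrix.smul_apply, smul_eq_mul, Matrix.single_mul_mul_single,
    one_mul, mul_one, Matrix.single_apply, Matrix.trace, Matrix.diag, Matrix.one_apply]
  by_cases hij : i = j
  · subst hij
    simp
  · rw [if_neg hij, mul_zero]
    refine Finset.sum_eq_zero fun a _ => Finset.sum_eq_zero fun b _ => if_neg ?_
    rintro ⟨rfl, h⟩
    exact hij h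

/-- The embedding of operators on the second tensor factor. -/
noncomputable def onRight (m : Type*) [Fintype m] [DecidableEq m] :
    Matrix m m ℂ →ₐ[ℂ] Matrix (m × m) (m × m) ℂ :=
  AlgHom.ofLinearMap
    { toFun := fun K => (1 : Matrix m m ℂ) ⊗ₖ K
      map_add' := fun A B => Matrix.kronecker_add _ A B
      map_smul' := fun c A => Matrix.kronecker_smul c _ A }
    Matrix.one_kronecker_one
    (fun A B => by
      change (1 : Matrix m m ℂ) ⊗ₖ (A * B) = (1 ⊗ₖ A) * (1 ⊗ₖ B)
      rw [← Matrix.mul_kronecker_mul, one_mul])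

theorem onRight_apply (K : Matrix m m ℂ) : onRight m K = (1 : Matrix m m ℂ) ⊗ₖ K := rfl

theorem onRight_mulVec (K X : Matrix m m ℂ) : onRight m K *ᵥ X.vec = (K * X).vec := by
  rw [onRight_apply, Matrix.kronecker_mulVec_vec, Matrix.transpose_one, mul_one]

theorem sum_onRight_single_mul_mul (O : Matrix (m × m) (m × m) ℂ) :
    ∑ a, ∑ b, onRight m (Matrix.single b a 1) * O * onRight m (Matrix.single a b 1) =
      partialTraceRight O ⊗ₖ 1 := by
  have hl (b a : m) (i j : m × m) : (onRight m (Matrix.single b a 1) * O) i j =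
      if b = i.2 then O (i.1, a) j else 0 := by
    rw [Matrix.mul_apply, Fintype.sum_prod_type]
    simp [onRight_apply, Matrix.one_apply, Matrix.single_apply, ite_and]
  have hr (a b : m) (N : Matrix (m × m) (m × m) ℂ) (i j : m × m) :
      (N * onRight m (Matrix.single a b 1)) i j = if b = j.2 then N i (j.1, a) else 0 := by
    rw [Matrix.mul_apply, Fintype.sum_prod_type]
    simp [onRight_apply, Matrix.one_apply, Matrix.single_apply, ite_and]
  ext i j
  simp only [Matrix.sum_apply, hr, hl, Matrix.kroneckerMap_apply, partialTraceRight,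
    Matrix.of_apply, Matrix.one_apply, mul_ite, mul_one, mul_zero, Finset.sum_ite_eq',
    Finset.mem_univ, if_true]
  by_cases h : i.2 = j.2 <;> simp [h, eq_comm]

theorem trace_mul_kronecker_one (O : Matrix (m × m) (m × m) ℂ) (A : Matrix m m ℂ) :
    (O * (A ⊗ₖ (1 : Matrix m m ℂ))).trace = (partialTraceRight O * A).trace := by
  simp only [Matrix.trace, Matrix.diag, Matrix.mul_apply, Fintype.sum_prod_type (γ := ℂ)
    (α₁ := m) (α₂ := m), Matrix.kroneckerMap_apply, Matrix.one_apply, mul_ite, mul_one, mul_zero,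
    Finset.sum_ite_eq', Finset.mem_univ, if_true, partialTraceRight, Matrix.of_apply,
    Finset.sum_mul]
  refine Finset.sum_congr rfl fun j _ => ?_
  rw [Finset.sum_comm]

end Index

/-- The functional `O ↦ ∫ ⟨U ⊗ U| O |U ⊗ U⟩ dU` on the symmetric or antisymmetric subspace. -/
noncomputable def twirl (n : Type*) [Fintype n] [DecidableEq n] (s : ℝ) :
    Matrix ((n × n) × (n × n)) ((n × n) × (n × n)) ℂ →ₗ[ℂ] ℂ where
  toFun O := ∫ U, star (symOp s U.1).vec ⬝ᵥ O *ᵥ (symOp s U.1).vec ∂haarUnitary n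
  map_add' O O' := by
    have h (O : Matrix ((n × n) × (n × n)) ((n × n) × (n × n)) ℂ) :
        Continuous fun U : Matrix.unitaryGroup n ℂ =>
          star (symOp s U.1).vec ⬝ᵥ O *ᵥ (symOp s U.1).vec :=
      (continuous_vec_symOp s).star.dotProduct
        (continuous_const.matrix_mulVec (continuous_vec_symOp s))
    simp only [Matrix.add_mulVec, dotProduct_add]
    exact integral_add (h O).integrable_haarUnitary (h O').integrable_haarUnitary
  map_smul' c O := by
    simp only [Matrix.smul_mulVec, dotProduct_smul, RingHom.id_apply]
    exact integral_smul c _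

theorem twirl_apply (s : ℝ) (O : Matrix ((n × n) × (n × n)) ((n × n) × (n × n)) ℂ) :
    twirl n s O = ∫ U, star (symOp s U.1).vec ⬝ᵥ O *ᵥ (symOp s U.1).vec ∂haarUnitary n := rfl

/-- Left invariance of Haar measure makes `twirl` invariant under conjugation by `1 ⊗ (V ⊗ V)`,
which for a unitary is the same as cyclicity. -/
theorem onRight_kronecker_mem_centralizerOf (s : ℝ) {V : Matrix n n ℂ}
    (hV : V ∈ Matrix.unitaryGroup n ℂ) :
    onRight (n × n) (V ⊗ₖ V) ∈ centralizerOf (twirl n s) := by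
  intro O
  have hV' : Vᴴ * V = 1 := Matrix.mem_unitaryGroup_iff'.1 hV
  set W := onRight (n × n) (V ⊗ₖ V) with hW
  have hWW : Wᴴ * W = 1 := by
    rw [hW, onRight_apply, Matrix.conjTranspose_kronecker, ← Matrix.mul_kronecker_mul,
      Matrix.conjTranspose_kronecker, ← Matrix.mul_kronecker_mul, hV']
    simp
  have hinv (N) : twirl n s N = twirl n s (Wᴴ * N * W) := by
    rw [twirl_apply, twirl_apply, ← integral_haarUnitary_mul_left ⟨V, hV⟩]
    refine integral_congr_ae (Filter.Eventually.of_forall fun U => ?_)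
    change star (symOp s (V * U.1)).vec ⬝ᵥ N *ᵥ (symOp s (V * U.1)).vec = _
    rw [← kronecker_mul_symOp, ← onRight_mulVec, ← hW, Matrix.star_mulVec,
      ← Matrix.dotProduct_mulVec, Matrix.mulVec_mulVec, Matrix.mulVec_mulVec]
  rw [hinv (W * O), ← mul_assoc, hWW, one_mul]

/-- Schur's lemma in the form of a trace computation: the averaged operator is a multiple of
`symProjBoth n s`. -/
theorem trace_symProj_mul_twirl [Nonempty n] {K : Type*} [Fintype K] [DecidableEq K]
    {σ : K → Matrix n n ℂ} {k₀ : K} (hσ : IsHermitianUnitaryBasis σ k₀) {s : ℝ} (hs : s ^ 2 = 1)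
    (O : Matrix ((n × n) × (n × n)) ((n × n) × (n × n)) ℂ) :
    (symProj n s).trace * twirl n s O = (O * symProjBoth n s).trace := by
  set P := symProj n s with hP
  let T := onRight (n × n)
  have hmem (M) : T (P * M * P) ∈ centralizerOf (twirl n s) :=
    symProj_mul_mul_symProj_mem hσ hs (𝒜 := (centralizerOf (twirl n s)).comap T)
      (fun V hV => onRight_kronecker_mem_centralizerOf s hV) M
  have hPP : P * P = P := symProj_mul_self hs
  have hsum : ∑ a, ∑ b, (P * Matrix.single a b 1 * P) * (P * Matrix.single b a 1 * P) =
      P.trace • P := by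
    have h (a b) : (P * Matrix.single a b (1 : ℂ) * P) * (P * Matrix.single b a 1 * P) =
        P * (Matrix.single a b 1 * P * Matrix.single b a 1) * P := by
      simp only [mul_assoc]
      rw [← mul_assoc P P, hPP]
    simp only [h, ← Matrix.mul_sum, ← Matrix.sum_mul, sum_single_mul_mul_single]
    rw [mul_smul_comm, mul_one, smul_mul_assoc, hPP]
  have hTP (N) : twirl n s (N * T P) = twirl n s N := by
    rw [twirl_apply, twirl_apply]
    refine integral_congr_ae (Filter.Eventually.of_forall fun U => ?_)
    change _ ⬝ᵥ (N * onRight _ P) *ᵥ _ = _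
    rw [← Matrix.mulVec_mulVec, onRight_mulVec, symProj_mul_symOp hs]
  have hTP' (N) : twirl n s (T P * N) = twirl n s N := by
    have h := hmem 1 N
    rw [mul_one, hPP] at h
    rw [← h, hTP]
  have h1 : P.trace * twirl n s O =
      ∑ a, ∑ b, twirl n s (O * T (P * Matrix.single a b 1 * P) * T (P * Matrix.single b a 1 * P)) := by
    rw [← hTP O, ← smul_eq_mul, ← map_smul, ← mul_smul_comm, ← map_smul T, ← hsum]
    simp only [map_sum, Matrix.mul_sum, map_mul, mul_assoc]
  -- Cyclicity brings the last factor to the front, and the outermost projections are absorbed by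
  -- the test vectors. The sum over matrix units then becomes a partial trace, whose form on `symOp
  -- s U` does not depend on `U`.
  have h2 (a b) :
      twirl n s (O * T (P * Matrix.single a b 1 * P) * T (P * Matrix.single b a 1 * P)) =
      twirl n s (T (Matrix.single b a 1) * (T P * O * T P) * T (Matrix.single a b 1)) := by
    rw [hmem (Matrix.single b a 1)]
    simp only [map_mul, mul_assoc]
    rw [hTP']
    simp only [← mul_assoc]
    rw [hTP]
  rw [h1]
  simp only [h2, ← map_sum]
  rw [sum_onRight_single_mul_mul, twirl_apply]
  have h3 (U : Matrix.unitaryGroup n ℂ) : star (symOp s U.1).vec ⬝ᵥ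
      (partialTraceRight (T P * O * T P) ⊗ₖ 1) *ᵥ (symOp s U.1).vec =
        (O * symProjBoth n s).trace := by
    have h4 : T P * (Pᵀ ⊗ₖ 1) * T P = symProjBoth n s := by
      simp only [T, onRight_apply, ← Matrix.mul_kronecker_mul, one_mul, mul_one, hPP]
      rfl
    rw [Matrix.kronecker_mulVec_vec, Matrix.star_vec_dotProduct_vec, one_mul, ← mul_assoc,
      conjTranspose_symOp_mul hs U.2, ← Matrix.trace_transpose, Matrix.transpose_mul,
      Matrix.transpose_transpose, ← trace_mul_kronecker_one, mul_assoc, mul_assoc,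
      Matrix.trace_mul_comm, mul_assoc, ← hP, h4]
  simp only [h3]
  simp

end Average

/-! ### Linear relations between Choi states -/

section ChoiRelations

variable {d : ℕ}

/-- With `u` and `v` the vectors of `U` and `P * U`, the cross terms of `(u ± iv)/√2` cancel. This
relation is what linearity of the cloner is used on. -/
theorem proj_choiVector_quarterTurn_add (P U : Matrix (Fin d) (Fin d) ℂ) :
    proj (choiVector (quarterTurn P Complex.I * U)) +
        proj (choiVector (quarterTurn P (-Complex.I) * U)) =
      proj (choiVector U) + proj (choiVector (P * U)) := by
  have h (ε : ℂ) : choiVector (quarterTurn P ε * U) =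
      ((Real.sqrt 2 : ℝ) : ℂ)⁻¹ • (choiVector U + ε • choiVector (P * U)) := by
    ext x
    simp only [choiVector, quarterTurn, smul_mul_assoc, add_mul, one_mul, Matrix.smul_apply,
      Matrix.add_apply, Pi.smul_apply, Pi.add_apply, smul_eq_mul]
    ring
  have hstar : star ((Real.sqrt 2 : ℝ) : ℂ)⁻¹ = ((Real.sqrt 2 : ℝ) : ℂ)⁻¹ := by simp
  have hsq := inv_sqrt_two_mul_self
  ext x y
  simp only [h, proj, Matrix.add_apply, Matrix.vecMulVec_apply, Pi.star_apply, Pi.smul_apply,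
    Pi.add_apply, smul_eq_mul, star_mul', star_add, hstar, star_neg, Complex.star_def,
    Complex.conj_I]
  set c := ((Real.sqrt 2 : ℝ) : ℂ)⁻¹
  set u := choiVector U x
  set v := choiVector (P * U) x
  set u' := (starRingEnd ℂ) (choiVector U y)
  set v' := (starRingEnd ℂ) (choiVector (P * U) y)
  linear_combination (2 * (u * u' + v * v')) * hsq - (2 * c * c * (v * v')) * Complex.I_mul_I

/-- Right multiplication by a unitary carries the basis `σ` to another orthogonal basis, so the
associated Choi vectors are an orthonormal basis. -/
theorem sum_proj_choiVector {K : Type*} [Fintype K] [DecidableEq K]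
    {σ : K → Matrix (Fin d) (Fin d) ℂ} {k₀ : K} (hσ : IsHermitianUnitaryBasis σ k₀)
    {U : Matrix (Fin d) (Fin d) ℂ} (hU : U ∈ Matrix.unitaryGroup (Fin d) ℂ) :
    ∑ k, proj (choiVector (σ k * U)) = 1 := by
  ext x y
  have hd : (d : ℂ) ≠ 0 := by exact_mod_cast (Fin.pos x.1).ne'
  have hsq : ((Real.sqrt d : ℝ) : ℂ) * ((Real.sqrt d : ℝ) : ℂ) = d := by
    rw [← Complex.ofReal_mul, Real.mul_self_sqrt (by positivity)]
    simp
  have h (k) : proj (choiVector (σ k * U)) x y =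
      (σ k * U) x.1 x.2 * star ((σ k * U) y.1 y.2) * (d : ℂ)⁻¹ := by
    simp only [proj, Matrix.vecMulVec_apply, Pi.star_apply, choiVector, star_div₀,
      Complex.star_def, Complex.conj_ofReal]
    rw [div_mul_div_comm, hsq, div_eq_mul_inv]
  simp only [Matrix.sum_apply, h, ← Finset.sum_mul, hσ.sum_mul_mul_conjTranspose hU,
    Matrix.one_apply, Prod.ext_iff, Fintype.card_fin]
  split_ifs <;> simp [hd]

theorem continuous_proj_choiVector :
    Continuous fun U : Matrix (Fin d) (Fin d) ℂ => proj (choiVector U) := by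
  have h (x : Fin d × Fin d) :
      Continuous fun U : Matrix (Fin d) (Fin d) ℂ => choiVector U x :=
    (continuous_id.matrix_elem _ _).div_const _
  refine continuous_matrix fun x y => ?_
  exact (h x).mul (h y).star

end ChoiRelations

/-! ### Haar averages of the clones and the bound on each subspace -/

section AverageBound

variable {d : ℕ}

theorem continuous_quad {X κ : Type*} [TopologicalSpace X] [Fintype κ] {ρ : X → Matrix κ κ ℂ}
    {v : X → κ → ℂ} (hρ : Continuous ρ) (hv : Continuous v) :
    Continuous fun x => quad (ρ x) (v x) :=
  Complex.continuous_re.comp (hv.star.dotProduct (hρ.matrix_mulVec hv))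

theorem quad_add_left {κ : Type*} [Fintype κ] (ρ ρ' : Matrix κ κ ℂ) (v : κ → ℂ) :
    quad (ρ + ρ') v = quad ρ v + quad ρ' v := by
  simp [quad, Matrix.add_mulVec, dotProduct_add]

theorem quad_sum_left {κ K : Type*} [Fintype κ] [Fintype K] (ρ : K → Matrix κ κ ℂ) (v : κ → ℂ) :
    quad (∑ k, ρ k) v = ∑ k, quad (ρ k) v := by
  simp [quad, Matrix.sum_mulVec, dotProduct_sum]

theorem continuous_vec_mul_symOp {n : Type*} [Fintype n] [DecidableEq n] (s : ℝ)
    (M : Matrix (n × n) (n × n) ℂ) :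
    Continuous fun U : Matrix.unitaryGroup n ℂ => (M * symOp s U.1).vec := by
  simp only [← onRight_mulVec]
  exact continuous_const.matrix_mulVec (continuous_vec_symOp s)

variable {K : Type*} [Fintype K] [DecidableEq K]
  {σ : K → Matrix (Fin d) (Fin d) ℂ} {k₀ : K}
  (L : Matrix (Fin d × Fin d) (Fin d × Fin d) ℂ →ₗ[ℝ]
    Matrix ((Fin d × Fin d) × (Fin d × Fin d)) ((Fin d × Fin d) × (Fin d × Fin d)) ℂ)

theorem continuous_linearMap_choiVector :
    Continuous fun U : Matrix (Fin d) (Fin d) ℂ => L (proj (choiVector U)) :=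
  L.continuous_of_finiteDimensional.comp continuous_proj_choiVector

theorem continuous_linearMap_choiVector_coe :
    Continuous fun U : Matrix.unitaryGroup (Fin d) ℂ => L (proj (choiVector U.1)) :=
  (continuous_linearMap_choiVector L).comp continuous_subtype_val

theorem continuous_linearMap_choiVector_mul (V : Matrix (Fin d) (Fin d) ℂ) :
    Continuous fun U : Matrix.unitaryGroup (Fin d) ℂ => L (proj (choiVector (V * U.1))) :=
  (continuous_linearMap_choiVector L).comp (continuous_const.matrix_mul continuous_subtype_val)

/-- Shifting the Haar average moves a unitary from the test vector to the input state. -/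
theorem integral_quad_symOp_mul (s : ℝ) {V W : Matrix (Fin d) (Fin d) ℂ}
    (hV : V ∈ Matrix.unitaryGroup (Fin d) ℂ) (hVW : V * W = 1) :
    ∫ U, quad (L (proj (choiVector U.1))) (symOp s (W * U.1)).vec ∂haarUnitary (Fin d) =
      ∫ U, quad (L (proj (choiVector (V * U.1)))) (symOp s U.1).vec ∂haarUnitary (Fin d) := by
  have hWV : W * V = 1 := mul_eq_one_comm.1 hVW
  rw [← integral_haarUnitary_mul_left ⟨V, hV⟩]
  refine integral_congr_ae (Filter.Eventually.of_forall fun U => ?_)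
  change quad (L (proj (choiVector (V * U.1)))) (symOp s (W * (V * U.1))).vec = _
  rw [← mul_assoc, hWV, one_mul]

theorem integral_add_add_two_mul {X : Type*} [MeasurableSpace X] {μ : Measure X} {a b c : X → ℝ}
    (ha : Integrable a μ) (hb : Integrable b μ) (hc : Integrable c μ) :
    ∫ x, a x + b x + 2 * c x ∂μ = (∫ x, a x ∂μ) + (∫ x, b x ∂μ) + 2 * ∫ x, c x ∂μ := by
  rw [integral_add (f := fun x => a x + b x) (ha.add hb) (hc.const_mul 2), integral_add ha hb,
    integral_const_mul]

theorem integral_add_sub_two_mul_add {X : Type*} [MeasurableSpace X] {μ : Measure X}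
    {a b c e : X → ℝ} (ha : Integrable a μ) (hb : Integrable b μ) (hc : Integrable c μ)
    (he : Integrable e μ) :
    ∫ x, a x + b x - 2 * c x + e x ∂μ =
      (∫ x, a x ∂μ) + (∫ x, b x ∂μ) - 2 * (∫ x, c x ∂μ) + ∫ x, e x ∂μ := by
  rw [integral_add (f := fun x => a x + b x - 2 * c x) ((ha.add hb).sub (hc.const_mul 2)) he,
    integral_sub (f := fun x => a x + b x) (ha.add hb) (hc.const_mul 2), integral_add ha hb,
    integral_const_mul]

/-- The forms at the two rotated test vectors are averaged in two ways: directly, by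
`quad_quarterTurn_add`, and after shifting the rotations onto the input state, by the four-term
relation of Choi states. Equating the results isolates the `gen` term. -/
theorem integral_quad_gen (hσ : IsHermitianUnitaryBasis σ k₀)
    (hL : ∀ U ∈ Matrix.unitaryGroup (Fin d) ℂ, (L (proj (choiVector U))).PosSemidef) (s : ℝ)
    (k : K) :
    ∫ U, quad (L (proj (choiVector U.1))) (gen (σ k) * symOp s U.1).vec ∂haarUnitary (Fin d) =
      ∫ U, quad (L (proj (choiVector U.1))) (symOp s U.1).vec +
        quad (L (proj (choiVector (σ k * U.1)))) (symOp s U.1).vec +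
        2 * (star (symOp s U.1).vec ⬝ᵥ L (proj (choiVector U.1)) *ᵥ
          ((σ k ⊗ₖ σ k) * symOp s U.1).vec).re ∂haarUnitary (Fin d) := by
  have hρ := continuous_linearMap_choiVector_coe L
  have hx := continuous_vec_symOp (n := Fin d) s
  have hmul := continuous_vec_mul_symOp (n := Fin d) s
  have hmul' := continuous_linearMap_choiVector_mul L
  have hσk := hσ.mem_unitaryGroup k
  have hm1 := quarterTurn_mem_unitaryGroup (hσ.isHermitian k) (hσ.mul_self k)
    Complex.I_mul_I (by simp)
  have hm2 := quarterTurn_mem_unitaryGroup (hσ.isHermitian k) (hσ.mul_self k)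
    (ε := -Complex.I) (by simp) (by simp)
  have hq1 := quarterTurn_mul_quarterTurn (hσ.mul_self k) Complex.I_mul_I
  have hq2 := mul_eq_one_comm.1 hq1
  have e1 := integral_quad_symOp_mul L s hm2 hq2
  have e2 := integral_quad_symOp_mul L s hm1 hq1
  have e3 := integral_quad_symOp_mul L s hσk (hσ.mul_self k)
  simp only [← kronecker_mul_symOp] at e1 e2 e3
  have i0 := (continuous_quad hρ hx).integrable_haarUnitary
  have i1 := (continuous_quad hρ (hmul (quarterTurn (σ k) Complex.I ⊗ₖ
    quarterTurn (σ k) Complex.I))).integrable_haarUnitary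
  have i2 := (continuous_quad hρ (hmul (quarterTurn (σ k) (-Complex.I) ⊗ₖ
    quarterTurn (σ k) (-Complex.I)))).integrable_haarUnitary
  have i3 := (continuous_quad hρ (hmul (σ k ⊗ₖ σ k))).integrable_haarUnitary
  have i4 := (continuous_quad hρ (hmul (gen (σ k)))).integrable_haarUnitary
  have i5 : Integrable (fun U : Matrix.unitaryGroup (Fin d) ℂ => (star (symOp s U.1).vec ⬝ᵥ
      L (proj (choiVector U.1)) *ᵥ ((σ k ⊗ₖ σ k) * symOp s U.1).vec).re) (haarUnitary (Fin d)) :=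
    (Complex.continuous_re.comp (hx.star.dotProduct
      (hρ.matrix_mulVec (hmul (σ k ⊗ₖ σ k))))).integrable_haarUnitary
  have j1 := (continuous_quad (hmul' (quarterTurn (σ k) Complex.I)) hx).integrable_haarUnitary
  have j2 := (continuous_quad (hmul' (quarterTurn (σ k) (-Complex.I))) hx).integrable_haarUnitary
  have j3 := (continuous_quad (hmul' (σ k)) hx).integrable_haarUnitary
  have key : (∫ U, quad (L (proj (choiVector (quarterTurn (σ k) Complex.I * U.1))))
        (symOp s U.1).vec ∂haarUnitary (Fin d)) +
      (∫ U, quad (L (proj (choiVector (quarterTurn (σ k) (-Complex.I) * U.1))))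
        (symOp s U.1).vec ∂haarUnitary (Fin d)) =
      (∫ U, quad (L (proj (choiVector U.1))) (symOp s U.1).vec ∂haarUnitary (Fin d)) +
      ∫ U, quad (L (proj (choiVector (σ k * U.1)))) (symOp s U.1).vec ∂haarUnitary (Fin d) := by
    rw [← integral_add j1 j2, ← integral_add i0 j3]
    simp only [← quad_add_left, ← map_add, proj_choiVector_quarterTurn_add]
  rw [← e1, ← e2] at key
  replace key := (add_comm _ _).trans key
  rw [← integral_add i1 i2] at key
  have hpt (U : Matrix.unitaryGroup (Fin d) ℂ) := quad_quarterTurn_add (P := σ k)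
    (hL U.1 U.2).1 (symOp s U.1)
  simp only [hpt] at key
  rw [integral_const_mul, integral_add_sub_two_mul_add i0 i3 i5 i4, e3] at key
  rw [integral_add_add_two_mul i0 j3 i5]
  linarith

/-- Summed over `k`, the rotated inputs add up to `L 1`, and `∑ σ k ⊗ σ k` is `d` times the swap,
which acts on `symOp s U` as the scalar `s`. -/
theorem sum_integral_quad_gen [NeZero d] (hσ : IsHermitianUnitaryBasis σ k₀)
    (hL : ∀ U ∈ Matrix.unitaryGroup (Fin d) ℂ, (L (proj (choiVector U))).PosSemidef) {s : ℝ}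
    (hs : s ^ 2 = 1) :
    ∑ k, ∫ U, quad (L (proj (choiVector U.1))) (gen (σ k) * symOp s U.1).vec
        ∂haarUnitary (Fin d) =
      (d ^ 2 + 2 * s * d) *
        (∫ U, quad (L (proj (choiVector U.1))) (symOp s U.1).vec ∂haarUnitary (Fin d)) +
      ∫ U, quad (L 1) (symOp s U.1).vec ∂haarUnitary (Fin d) := by
  have hρ := continuous_linearMap_choiVector_coe L
  have hx := continuous_vec_symOp (n := Fin d) s
  have hmul' := continuous_linearMap_choiVector_mul L
  have hmul := continuous_vec_mul_symOp (n := Fin d) s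
  have i0 := (continuous_quad hρ hx).integrable_haarUnitary
  have iΩ := (continuous_quad (continuous_const (y := L 1)) hx).integrable_haarUnitary
  have hint (k : K) : Integrable (fun U : Matrix.unitaryGroup (Fin d) ℂ =>
      quad (L (proj (choiVector U.1))) (symOp s U.1).vec +
        quad (L (proj (choiVector (σ k * U.1)))) (symOp s U.1).vec +
        2 * (star (symOp s U.1).vec ⬝ᵥ L (proj (choiVector U.1)) *ᵥ
          ((σ k ⊗ₖ σ k) * symOp s U.1).vec).re) (haarUnitary (Fin d)) :=
    (((continuous_quad hρ hx).add (continuous_quad (hmul' (σ k)) hx)).add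
      (continuous_const.mul (Complex.continuous_re.comp (hx.star.dotProduct
        (hρ.matrix_mulVec (hmul (σ k ⊗ₖ σ k))))))).integrable_haarUnitary
  have hcard : (Fintype.card K : ℝ) = (d : ℝ) ^ 2 := by simpa using hσ.card_eq
  simp only [integral_quad_gen L hσ hL]
  rw [← integral_finsetSum _ fun k _ => hint k, ← integral_const_mul,
    ← integral_add (i0.const_mul _) iΩ]
  refine integral_congr_ae (Filter.Eventually.of_forall fun U => ?_)
  have h1 : ∑ k, quad (L (proj (choiVector (σ k * U.1)))) (symOp s U.1).vec =
      quad (L 1) (symOp s U.1).vec := by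
    rw [← quad_sum_left, ← map_sum, sum_proj_choiVector hσ U.2]
  have h2 : ∑ k, (star (symOp s U.1).vec ⬝ᵥ L (proj (choiVector U.1)) *ᵥ
      ((σ k ⊗ₖ σ k) * symOp s U.1).vec).re =
        d * s * quad (L (proj (choiVector U.1))) (symOp s U.1).vec := by
    rw [← Complex.re_sum, ← dotProduct_sum, ← Matrix.mulVec_sum, ← Matrix.vec_sum,
      ← Matrix.sum_mul, hσ.sum_kronecker, smul_mul_assoc, swapMatrix_mul_symOp hs, smul_smul,
      Matrix.vec_smul, Matrix.mulVec_smul, dotProduct_smul, smul_eq_mul, Fintype.card_fin,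
      ← Complex.ofReal_natCast, ← Complex.ofReal_mul, Complex.re_ofReal_mul, quad]
  simp only [Finset.sum_add_distrib, ← Finset.mul_sum, h1, h2, Finset.sum_const,
    Finset.card_univ, nsmul_eq_mul, hcard]
  ring

/-- By Haar invariance all `d²` translates by `σ k` have the same average, while their projectors
sum to the identity. -/
theorem integral_trace_mul_symProjBoth [NeZero d] (hσ : IsHermitianUnitaryBasis σ k₀) (s : ℝ) :
    (d : ℝ) ^ 2 * ∫ U, (L (proj (choiVector U.1)) * symProjBoth (Fin d) s).trace.re
        ∂haarUnitary (Fin d) = (L 1 * symProjBoth (Fin d) s).trace.re := by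
  have hcard : (Fintype.card K : ℝ) = (d : ℝ) ^ 2 := by simpa using hσ.card_eq
  have hρ := continuous_linearMap_choiVector_coe L
  have hcont : Continuous fun U : Matrix.unitaryGroup (Fin d) ℂ =>
      (L (proj (choiVector U.1)) * symProjBoth (Fin d) s).trace.re :=
    Complex.continuous_re.comp (hρ.matrix_mul continuous_const).matrix_trace
  have hshift (k : K) := integral_haarUnitary_mul_left
    (⟨σ k, hσ.mem_unitaryGroup k⟩ : Matrix.unitaryGroup (Fin d) ℂ) fun U =>
      (L (proj (choiVector U.1)) * symProjBoth (Fin d) s).trace.re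
  have hsum : ∑ k, ∫ U : Matrix.unitaryGroup (Fin d) ℂ,
      (L (proj (choiVector (σ k * U.1))) * symProjBoth (Fin d) s).trace.re
        ∂haarUnitary (Fin d) = (L 1 * symProjBoth (Fin d) s).trace.re := by
    rw [← integral_finsetSum]
    · simp only [← Complex.re_sum, ← Matrix.trace_sum, ← Matrix.sum_mul, ← map_sum]
      simp [sum_proj_choiVector hσ (Subtype.property _)]
    · exact fun k _ => (hcont.comp (continuous_const_mul
        (⟨σ k, hσ.mem_unitaryGroup k⟩ : Matrix.unitaryGroup (Fin d) ℂ))).integrable_haarUnitary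
  rw [← hsum, ← hcard, ← nsmul_eq_mul, ← Finset.card_univ, ← Finset.sum_const]
  exact Finset.sum_congr rfl fun k _ => (hshift k).symm

theorem integral_quad_one [NeZero d] (hσ : IsHermitianUnitaryBasis σ k₀) {s : ℝ}
    (hs : s ^ 2 = 1)
    (O : Matrix ((Fin d × Fin d) × (Fin d × Fin d)) ((Fin d × Fin d) × (Fin d × Fin d)) ℂ) :
    2⁻¹ * (d * (d + s)) * ∫ U, quad O (symOp s U.1).vec ∂haarUnitary (Fin d) =
      (O * symProjBoth (Fin d) s).trace.re := by
  have h := trace_symProj_mul_twirl hσ hs O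
  have hx := continuous_vec_symOp (n := Fin d) s
  have hint : Integrable (fun U : Matrix.unitaryGroup (Fin d) ℂ => star (symOp s U.1).vec ⬝ᵥ
      O *ᵥ (symOp s U.1).vec) (haarUnitary (Fin d)) :=
    (hx.star.dotProduct (continuous_const.matrix_mulVec hx)).integrable_haarUnitary
  have hre : (twirl (Fin d) s O).re = ∫ U, quad O (symOp s U.1).vec ∂haarUnitary (Fin d) :=
    (integral_re hint).symm
  rw [← h, ← hre, trace_symProj, Fintype.card_fin]
  have hc : (2⁻¹ * ((d : ℂ) * (d + s))) = ((2⁻¹ * (d * (d + s)) : ℝ) : ℂ) := by push_cast; rfl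
  rw [hc, Complex.re_ofReal_mul]

theorem integral_quad_symOp_le [NeZero d] (hσ : IsHermitianUnitaryBasis σ k₀)
    (hL : ∀ U ∈ Matrix.unitaryGroup (Fin d) ℂ, (L (proj (choiVector U))).PosSemidef)
    (hmarg : ∀ U ∈ Matrix.unitaryGroup (Fin d) ℂ, ∀ j j',
      ∑ i, L (proj (choiVector U)) (j, i) (j', i) =
        if j = j' then ((((d : ℝ) ^ 2)⁻¹ : ℝ) : ℂ) else 0)
    {s : ℝ} (hs : s ^ 2 = 1) (hd : 0 < d + 3 * s ∨ (2 : ℝ)⁻¹ * (d * (d + s)) = 1) :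
    ∫ U, quad (L (proj (choiVector U.1))) (symOp s U.1).vec ∂haarUnitary (Fin d) ≤
      ((d : ℝ) ^ 2)⁻¹ * (2⁻¹ * (d * (d + s))) := by
  have hρ := continuous_linearMap_choiVector_coe L
  have hx := continuous_vec_symOp (n := Fin d) s
  have hmul := continuous_vec_mul_symOp (n := Fin d) s
  have i0 := (continuous_quad hρ hx).integrable_haarUnitary
  have it : Integrable (fun U : Matrix.unitaryGroup (Fin d) ℂ =>
      (L (proj (choiVector U.1)) * symProjBoth (Fin d) s).trace.re) (haarUnitary (Fin d)) :=
    (Complex.continuous_re.comp (hρ.matrix_mul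
      continuous_const).matrix_trace).integrable_haarUnitary
  set Q := ∫ U, quad (L (proj (choiVector U.1))) (symOp s U.1).vec ∂haarUnitary (Fin d) with hQ
  set T := ∫ U, (L (proj (choiVector U.1)) * symProjBoth (Fin d) s).trace.re
    ∂haarUnitary (Fin d) with hT
  have hTle : T ≤ ((d : ℝ) ^ 2)⁻¹ * (2⁻¹ * (d * (d + s))) := by
    have h := integral_mono it (integrable_const _)
      fun U => trace_mul_symProjBoth_le hs (hL U.1 U.2) (hmarg U.1 U.2)
    simpa using h
  refine le_trans ?_ hTle
  have hdpos : (0 : ℝ) < d := by exact_mod_cast Nat.pos_of_ne_zero (NeZero.ne d)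
  -- If `d + 3 * s > 0`, Bessel's inequality for the tangent vectors applies; otherwise the subspace
  -- is a line.
  rcases hd with hd | hd
  · have hs' : s = 1 ∨ s = -1 := by
      rcases mul_self_eq_one_iff.1 ((sq s).symm.trans hs) with h | h <;> simp [h]
    have h1 : 0 < d + s := by rcases hs' with rfl | rfl <;> linarith
    have h2 : 0 < d + 2 * s := by rcases hs' with rfl | rfl <;> linarith
    have hB : ∑ k, (∫ U, quad (L (proj (choiVector U.1))) (gen (σ k) * symOp s U.1).vec
          ∂haarUnitary (Fin d)) / (d * (d + 2 * s) + if k = k₀ then (d : ℝ) ^ 2 else 0) ≤ T := by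
      simp only [← integral_div]
      rw [← integral_finsetSum _ fun k _ =>
        (continuous_quad hρ (hmul (gen (σ k)))).integrable_haarUnitary.div_const _]
      refine integral_mono (integrable_finsetSum _ fun k _ =>
        (continuous_quad hρ (hmul (gen (σ k)))).integrable_haarUnitary.div_const _) it fun U => ?_
      have h := sum_quad_gen_le hσ hs U.2 (hL U.1 U.2)
        (by rw [Fintype.card_fin]; positivity)
      simpa only [Fintype.card_fin] using h
    have h0 : ∫ U, quad (L (proj (choiVector U.1))) (gen (σ k₀) * symOp s U.1).vec
        ∂haarUnitary (Fin d) = 4 * Q := by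
      rw [hQ, ← integral_const_mul]
      refine integral_congr_ae (Filter.Eventually.of_forall fun U => ?_)
      have hg : gen (σ k₀) * symOp s U.1 = (2 : ℂ) • symOp s U.1 := by
        rw [hσ.eq_one, gen, Matrix.one_kronecker_one, add_mul, one_mul, two_smul]
      simp only [hg, Matrix.vec_smul, quad_smul]
      norm_num
    have hsum := sum_integral_quad_gen L hσ hL hs
    have hΩ := integral_quad_one hσ hs (L 1)
    rw [← integral_trace_mul_symProjBoth L hσ s, ← hT] at hΩ
    rw [← hQ] at hsum
    rw [Fintype.sum_eq_add_sum_compl k₀] at hB hsum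
    rw [h0] at hB hsum
    have hrest : ∑ k ∈ {k₀}ᶜ,
        (∫ U, quad (L (proj (choiVector U.1))) (gen (σ k) * symOp s U.1).vec
          ∂haarUnitary (Fin d)) / (d * (d + 2 * s) + if k = k₀ then (d : ℝ) ^ 2 else 0) =
        (∑ k ∈ {k₀}ᶜ, ∫ U, quad (L (proj (choiVector U.1))) (gen (σ k) * symOp s U.1).vec
          ∂haarUnitary (Fin d)) / (d * (d + 2 * s)) := by
      rw [Finset.sum_div]
      refine Finset.sum_congr rfl fun k hk => ?_
      have hk' : k ≠ k₀ := by simpa using hk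
      rw [if_neg hk', add_zero]
    rw [hrest, if_pos rfl] at hB
    set R := ∑ k ∈ {k₀}ᶜ, ∫ U, quad (L (proj (choiVector U.1))) (gen (σ k) * symOp s U.1).vec
      ∂haarUnitary (Fin d)
    set a := ∫ U, quad (L 1) (symOp s U.1).vec ∂haarUnitary (Fin d)
    have ha : a = 2 * d * T / (d + s) := by
      field_simp at hΩ ⊢
      linarith
    have hR : R = (d ^ 2 + 2 * s * d) * Q + a - 4 * Q := by linarith
    -- After eliminating `R` and `a`, Bessel's inequality contains only `Q` and `T`, and its slack
    -- is a multiple of `Q - T`. The factor `d + 3 * s` decides the sign.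
    have hfin : 4 * Q / (d * (d + 2 * s) + (d : ℝ) ^ 2) + R / (d * (d + 2 * s)) - T =
        d * (d + 3 * s) / ((d + s) * (d + 2 * s)) * (Q - T) := by
      have h3 : (d * (d + 2 * s) + (d : ℝ) ^ 2) = 2 * (d * (d + s)) := by ring
      rw [h3, hR, ha]
      field_simp
      linear_combination 4 * d * (Q - T) * hs
    have hcoef : 0 < d * (d + 3 * s) / ((d + s) * (d + 2 * s)) := by positivity
    have hle : d * (d + 3 * s) / ((d + s) * (d + 2 * s)) * (Q - T) ≤ 0 := by linarith
    nlinarith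
  · refine integral_mono i0 it fun U => ?_
    have h := quad_vec_symOp_le hs U.2 (hL U.1 U.2)
      (by rw [Fintype.card_fin, hd]; exact one_pos)
    rwa [Fintype.card_fin, hd, one_mul] at h

end AverageBound

/-! ### Fidelity of two copies of a Choi state -/

theorem tensorPower_proj {ι : Type*} (m : ℕ) (ψ : ι → ℂ) :
    tensorPower m (proj ψ) = proj fun f : Fin m → ι => ∏ k, ψ (f k) := by
  ext f g
  simp [tensorPower, proj, Matrix.vecMulVec_apply, Finset.prod_mul_distrib]

theorem star_prod_dotProduct_prod {ι : Type*} [Fintype ι] [DecidableEq ι] (m : ℕ) {ψ : ι → ℂ}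
    (hψ : star ψ ⬝ᵥ ψ = 1) :
    star (fun f : Fin m → ι => ∏ k, ψ (f k)) ⬝ᵥ (fun f : Fin m → ι => ∏ k, ψ (f k)) = 1 := by
  have h := Fintype.sum_pow (fun x => star (ψ x) * ψ x) m
  rw [← one_pow m, ← hψ, dotProduct, dotProduct]
  simp only [Pi.star_apply, star_prod, ← Finset.prod_mul_distrib]
  exact h.symm

theorem star_choiVector_dotProduct {d : ℕ} [NeZero d] {U : Matrix (Fin d) (Fin d) ℂ}
    (hU : U ∈ Matrix.unitaryGroup (Fin d) ℂ) : star (choiVector U) ⬝ᵥ choiVector U = 1 := by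
  have hd : (d : ℂ) ≠ 0 := by exact_mod_cast NeZero.ne d
  have hsq : ((Real.sqrt d : ℝ) : ℂ) * ((Real.sqrt d : ℝ) : ℂ) = d := by
    rw [← Complex.ofReal_mul, Real.mul_self_sqrt (by positivity)]
    simp
  have h (x : Fin d × Fin d) : star (choiVector U x) * choiVector U x =
      star (U x.1 x.2) * U x.1 x.2 * (d : ℂ)⁻¹ := by
    simp only [choiVector, star_div₀, Complex.star_def, Complex.conj_ofReal]
    rw [div_mul_div_comm, hsq, div_eq_mul_inv]
  have htr : (Uᴴ * U).trace = d := by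
    have h : Uᴴ * U = 1 := Matrix.mem_unitaryGroup_iff'.1 hU
    rw [h]; simp
  simp only [Matrix.trace, Matrix.diag, Matrix.mul_apply, Matrix.conjTranspose_apply] at htr
  rw [Finset.sum_comm] at htr
  simp only [dotProduct, Pi.star_apply, h, ← Finset.sum_mul, Fintype.sum_prod_type, htr,
    mul_inv_cancel₀ hd]

theorem quad_submatrix {κ κ' : Type*} [Fintype κ] [Fintype κ'] (e : κ' ≃ κ) (ρ : Matrix κ κ ℂ)
    (v : κ → ℂ) : quad (ρ.submatrix e e) (v ∘ e) = quad ρ v := by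
  have h : ρ.submatrix e e *ᵥ (v ∘ e) = (ρ *ᵥ v) ∘ e := by
    rw [Matrix.submatrix_mulVec_equiv, Function.comp_assoc, e.self_comp_symm, Function.comp_id]
  rw [quad, h, quad]
  exact congrArg Complex.re (e.sum_comp fun i => star v i * (ρ *ᵥ v) i)

/-- The regrouping of two pairs (output, input) as (both inputs, both outputs). -/
def pairsEquiv (n : Type*) : (n × n) × (n × n) ≃ (Fin 2 → n × n) where
  toFun p := ![(p.2.1, p.1.1), (p.2.2, p.1.2)]
  invFun f := (((f 0).2, (f 1).2), ((f 0).1, (f 1).1))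
  left_inv _ := rfl
  right_inv f := by
    ext k : 1
    fin_cases k <;> rfl

/-- `Matrix.vec` lists the column index first, which is why `pairsEquiv` puts the inputs before the
outputs. -/
theorem prod_choiVector_comp_pairsEquiv {d : ℕ} (U : Matrix (Fin d) (Fin d) ℂ) :
    (fun f : Fin 2 → Fin d × Fin d => ∏ k, choiVector U (f k)) ∘ pairsEquiv (Fin d) =
      (d : ℂ)⁻¹ • (symOp 1 U + symOp (-1) U).vec := by
  have hsq : ((Real.sqrt d : ℝ) : ℂ) * ((Real.sqrt d : ℝ) : ℂ) = d := by
    rw [← Complex.ofReal_mul, Real.mul_self_sqrt (by positivity)]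
    simp
  rw [symOp, symOp, ← mul_add, symProj_one_add_symProj_neg_one, mul_one]
  ext p
  simp only [Function.comp_apply, Fin.prod_univ_two, choiVector, Pi.smul_apply, smul_eq_mul,
    Matrix.vec, Matrix.kroneckerMap_apply]
  rw [div_mul_div_comm, hsq, div_eq_inv_mul]
  rfl

theorem sum_submatrix_pairsEquiv {d : ℕ}
    {ω : Matrix (Fin 2 → Fin d × Fin d) (Fin 2 → Fin d × Fin d) ℂ} (hω : IsChoiState ω)
    (j j' : Fin d × Fin d) :
    ∑ i, ω.submatrix (pairsEquiv (Fin d)) (pairsEquiv (Fin d)) (j, i) (j', i) =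
      if j = j' then ((((d : ℝ) ^ 2)⁻¹ : ℝ) : ℂ) else 0 := by
  have h := congrFun (congrFun hω.2 ![j.1, j.2]) ![j'.1, j'.2]
  have hiff : (![j.1, j.2] : Fin 2 → Fin d) = ![j'.1, j'.2] ↔ j = j' := by
    constructor
    · intro h
      exact Prod.ext (congrFun h 0) (congrFun h 1)
    · rintro rfl; rfl
  simp only [Matrix.smul_apply, Matrix.one_apply, hiff, smul_eq_mul, mul_ite, mul_one,
    mul_zero] at h
  push_cast
  rw [← h, partialTraceFirst, Matrix.of_apply, ← (finTwoArrowEquiv (Fin d)).symm.sum_comp]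
  refine Finset.sum_congr rfl fun i _ => ?_
  rw [Matrix.submatrix_apply]
  congr 1 <;> · ext k : 1; fin_cases k <;> rfl

/-- The no-signalling principle makes a cloner of Choi states of unitaries act linearly. -/
theorem exists_linearMap_choiStates {d m : ℕ} [NeZero d] {K : Type*} [Fintype K] [DecidableEq K]
    {σ : K → Matrix (Fin d) (Fin d) ℂ} {k₀ : K} (hσ : IsHermitianUnitaryBasis σ k₀)
    (C : CloningOracle (choiStates d) 1 m) (hC : NoSignalling (choiStates d) 1 C.output) :
    ∃ L : Matrix (Fin d × Fin d) (Fin d × Fin d) ℂ →ₗ[ℝ]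
        Matrix (Fin m → Fin d × Fin d) (Fin m → Fin d × Fin d) ℂ,
      ∀ ψ ∈ choiStates d, L (proj ψ) = C.clone (tensorPower 1 (proj ψ)) := by
  choose U hU hψ using fun ψ : choiStates d => ψ.2
  refine C.exists_linearMap hC k₀ (fun ψ k => ⟨choiVector (σ k * U ψ), σ k * U ψ,
    mul_mem (hσ.mem_unitaryGroup k) (hU ψ), rfl⟩) (fun ψ => ?_) fun ψ =>
      sum_proj_choiVector hσ (hU ψ)
  exact Subtype.ext (by simp only [hσ.eq_one, one_mul]; exact (hψ ψ).symm)

end NoCloning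

/-! ### The fidelity bound -/

open NoCloning in
theorem mainTheorem6 (r : ℕ)
    (C : NoCloning.CloningOracle (NoCloning.choiStates (2 ^ r)) 1 2)
    (hsignal : NoCloning.NoSignalling (NoCloning.choiStates (2 ^ r)) 1 C.output)
    (hchoi : ∀ ψ ∈ NoCloning.choiStates (2 ^ r),
      NoCloning.IsChoiState (C.clone (NoCloning.tensorPower 1 (NoCloning.proj ψ)))) :
    C.worstCaseFidelity ≤
      ((2 : ℝ) ^ r + Real.sqrt ((2 : ℝ) ^ (2 * r) - 1)) / (2 : ℝ) ^ (3 * r) := by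
  obtain ⟨_, σ, k₀, hσ⟩ := exists_isHermitianUnitaryBasis r
  obtain ⟨L₀, hL₀⟩ := exists_linearMap_choiStates hσ C hsignal
  have hwc (U : Matrix (Fin (2 ^ r)) (Fin (2 ^ r)) ℂ) (hU : U ∈ Matrix.unitaryGroup _ ℂ) :
      C.worstCaseFidelity ≤ quad (L₀ (proj (choiVector U))) fun f => ∏ k, choiVector U (f k) := by
    have h := C.worstCaseFidelity_le ⟨U, hU, rfl⟩
    rwa [tensorPower_proj 2, fidelity_proj (hchoi _ ⟨U, hU, rfl⟩).1.1
      (star_prod_dotProduct_prod 2 (star_choiVector_dotProduct hU)), ← hL₀ _ ⟨U, hU, rfl⟩] at h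
  -- For `d = 1` the bound is `1`, and the fidelity with a unit vector is at most the trace.
  rcases Nat.eq_zero_or_pos r with rfl | hr
  · have h1 : (1 : Matrix (Fin (2 ^ 0)) (Fin (2 ^ 0)) ℂ) ∈ Matrix.unitaryGroup _ ℂ := one_mem _
    have hstate := (hchoi _ ⟨1, h1, rfl⟩).1
    rw [← hL₀ _ ⟨1, h1, rfl⟩] at hstate
    have h := sum_quad_div_le_trace_mul (ι := Unit) (c := fun _ => 1) hstate.1
      Matrix.conjTranspose_one (one_mul 1)
      (v := fun _ => fun f => ∏ k, choiVector 1 (f k)) (fun _ => one_pos)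
      (fun _ _ => by
        rw [star_prod_dotProduct_prod 2 (star_choiVector_dotProduct h1)]
        simp)
      (fun _ => Matrix.one_mulVec _)
    rw [mul_one, hstate.2] at h
    refine (hwc 1 h1).trans ?_
    simpa using h
  let d : ℕ := 2 ^ r
  let R : ℝ := Real.sqrt ((2 : ℝ) ^ (2 * r) - 1)
  let L : Matrix (Fin d × Fin d) (Fin d × Fin d) ℂ →ₗ[ℝ] Matrix ((Fin d × Fin d) × (Fin d × Fin d))
      ((Fin d × Fin d) × (Fin d × Fin d)) ℂ :=
    (Matrix.reindexLinearEquiv ℝ ℂ (pairsEquiv (Fin d)).symm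
      (pairsEquiv (Fin d)).symm).toLinearMap ∘ₗ L₀
  have hL (U) (hU : U ∈ Matrix.unitaryGroup (Fin d) ℂ) : L (proj (choiVector U)) =
      (C.clone (tensorPower 1 (proj (choiVector U)))).submatrix (pairsEquiv (Fin d))
        (pairsEquiv (Fin d)) := by
    rw [← hL₀ _ ⟨U, hU, rfl⟩]; rfl
  have hpos (U) (hU : U ∈ Matrix.unitaryGroup (Fin d) ℂ) :
      (L (proj (choiVector U))).PosSemidef := by
    rw [hL U hU]
    exact (hchoi _ ⟨U, hU, rfl⟩).1.1.submatrix _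
  have hmarg (U) (hU : U ∈ Matrix.unitaryGroup (Fin d) ℂ) (j j') :
      ∑ i, L (proj (choiVector U)) (j, i) (j', i) =
        if j = j' then ((((d : ℝ) ^ 2)⁻¹ : ℝ) : ℂ) else 0 := by
    rw [hL U hU]
    exact sum_submatrix_pairsEquiv (hchoi _ ⟨U, hU, rfl⟩) j j'
  have hd2 : 2 ≤ d := Nat.le_self_pow hr.ne' 2
  have hd2' : (2 : ℝ) ≤ d := by exact_mod_cast hd2
  have hdr : (2 : ℝ) ^ r = d := by simp [d]
  have hR : R = Real.sqrt ((d : ℝ) ^ 2 - 1) := by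
    simp only [R]
    rw [mul_comm, pow_mul, hdr]
  have hRR : R * R = (d + 1) * (d - 1) := by
    rw [hR, Real.mul_self_sqrt (by nlinarith)]
    ring
  have hRpos : 0 < R := by
    rw [hR]
    exact Real.sqrt_pos.2 (by nlinarith)
  -- The weight `η = R / (d + 1) = √((d - 1)/(d + 1))` is the square root of the ratio of the
  -- antisymmetric to the symmetric bound, hence optimal.
  have hsum : ∀ U : Matrix.unitaryGroup (Fin d) ℂ, (d : ℝ) ^ 2 * C.worstCaseFidelity ≤
      (1 + R / (d + 1)) * quad (L (proj (choiVector U.1))) (symOp 1 U.1).vec +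
      (1 + (R / (d + 1))⁻¹) * quad (L (proj (choiVector U.1))) (symOp (-1) U.1).vec := by
    intro U
    have h := hwc U.1 U.2
    rw [← quad_submatrix (pairsEquiv (Fin d)), prod_choiVector_comp_pairsEquiv, quad_smul,
      hL₀ _ ⟨U.1, U.2, rfl⟩, ← hL U.1 U.2] at h
    have hnorm : Complex.normSq ((d : ℂ)⁻¹) = ((d : ℝ) ^ 2)⁻¹ := by
      rw [map_inv₀, Complex.normSq_natCast, sq]
    have h2 := quad_add_le (hpos U.1 U.2) (symOp 1 U.1).vec (symOp (-1) U.1).vec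
      (η := R / (d + 1)) (by positivity)
    rw [← Matrix.vec_add] at h2
    refine le_trans ?_ h2
    rw [hnorm, le_inv_mul_iff₀ (by positivity)] at h
    exact h
  have hρ := continuous_linearMap_choiVector_coe L
  have i1 := (continuous_quad hρ (continuous_vec_symOp 1)).integrable_haarUnitary
  have i2 := (continuous_quad hρ (continuous_vec_symOp (-1))).integrable_haarUnitary
  have hint := integral_mono (integrable_const _) ((i1.const_mul _).add (i2.const_mul _)) hsum
  -- A power of two that is at least `2` is either `2`, with a one-dimensional antisymmetric
  -- subspace, or at least `4`; the degenerate value `3` does not occur.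
  have hcard2 : 0 < (d : ℝ) + 3 * (-1) ∨ (2 : ℝ)⁻¹ * (d * (d + -1)) = 1 := by
    rcases Nat.eq_or_lt_of_le hr with h | h
    · right
      have : (d : ℝ) = 2 := by rw [← hdr, ← h]; norm_num
      rw [this]; norm_num
    · left
      have : (2 : ℝ) ^ 2 ≤ 2 ^ r := pow_le_pow_right₀ one_le_two h
      rw [hdr] at this
      linarith
  have b1 := integral_quad_symOp_le L hσ hpos hmarg (s := 1) (by norm_num)
    (Or.inl (by positivity))
  have b2 := integral_quad_symOp_le L hσ hpos hmarg (s := -1) (by norm_num) hcard2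
  simp only [Pi.add_apply] at hint
  rw [integral_add (i1.const_mul _) (i2.const_mul _), integral_const, probReal_univ,
    one_smul] at hint
  simp only [integral_const_mul] at hint
  have hfinal : (d : ℝ) ^ 2 * C.worstCaseFidelity ≤
      (1 + R / (d + 1)) * (((d : ℝ) ^ 2)⁻¹ * (2⁻¹ * (d * (d + 1)))) +
      (1 + (R / (d + 1))⁻¹) * (((d : ℝ) ^ 2)⁻¹ * (2⁻¹ * (d * (d + -1)))) := by
    refine hint.trans ?_
    gcongr
  have heq : (1 + R / (d + 1)) * (((d : ℝ) ^ 2)⁻¹ * (2⁻¹ * (d * (d + 1)))) +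
      (1 + (R / (d + 1))⁻¹) * (((d : ℝ) ^ 2)⁻¹ * (2⁻¹ * (d * (d + -1)))) = (d + R) / d := by
    have hd0 : (d : ℝ) ≠ 0 := by positivity
    have hd1 : (d : ℝ) + 1 ≠ 0 := by positivity
    have hR0 := hRpos.ne'
    field_simp
    linear_combination (-1 : ℝ) * hRR
  rw [heq] at hfinal
  have hpow : (2 : ℝ) ^ (3 * r) = (d : ℝ) ^ 3 := by rw [mul_comm, pow_mul, hdr]
  rw [hdr, hpow]
  change _ ≤ (d + R) / (d : ℝ) ^ 3
  rw [le_div_iff₀ (by positivity)]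
  rw [le_div_iff₀ (by positivity)] at hfinal
  linarith
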